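/- Let $(X,Y),(X_1,Y_1),\dots,(X_n,Y_n)$ be i.i.d. random pairs with values in $\mathcal X\times\mathbb R$, where $\mathcal X$ is a measurable space, and let $P_X$ be the law of $X$. Assume that $Y$ is integrable, let $f(x)=\mathbf E(Y\mid X=x)$ be the regression function, and assume that the error $\xi=Y-f(X)$ satisfies $\mathbf E[\xi^2]<\infty$. Write $\|\cdot\|_{P_X,s}$ for the norm of $L^s(\mathcal X,P_X)$. Let $M\ge 2$, let $\phi_1,\dots,\phi_M:\mathcal X\to\mathbb R$ be measurable with $\|\phi_j\|_{P_X,2}=1$ and $\|\phi_j\|_{P_X,\infty}\le L_\phi$ for all $j$, where $L_\phi>0$ is a constant, and put $f_\lambda=\sum_{j=1}^M\lambda_j\phi_j$ for $\lambda\in\mathbb R^M$. Let $\tau,R>0$, $\Lambda=\{\lambda\in\mathbb R^M:\|\lambda\|_1\le R\}$ with $\|\lambda\|_1=\sum_j|\lambda_j|$, and let the sparsity prior $\pi$ be the probability measure on $\mathbb R^M$ given by $$\pi(d\lambda)=\frac1{C_{\tau,R}}\Big\{\prod_{j=1}^M(\tau^2+\lambda_j^2)^{-2}\Big\}\mathbf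 1(\|\lambda\|_1\le R)\,d\lambda .$$ For $\beta>0$, the mirror averaging (MA) aggregate is $$\hat f_n(x)=\frac1{n+1}\sum_{m=0}^n\int_\Lambda f_\lambda(x)\,\hat\theta_{m,\lambda}\,\pi(d\lambda),\qquad \hat\theta_{m,\lambda}=\frac{\exp\{-\frac1\beta\sum_{i=1}^m(Y_i-f_\lambda(X_i))^2\}}{\int_\Lambda\exp\{-\frac1\beta\sum_{i=1}^m(Y_i-f_w(X_i))^2\}\,\pi(dw)} .$$ Assume that for some $b>0$ and $\sigma^2>0$, $P_X$-almost surely, $$\mathbf E(e^{t\xi}\mid X)\le e^{\sigma^2t^2/2}\quad\text{for all } |t|\le b .$$ Then for every (finite) $\beta\ge\max\big(2\sigma^2+2\sup_{\lambda\in\Lambda}\|f_\lambda-f\|_{P_X,\infty}^2,\ 4RL_\phi/b\big)$ the MA aggregate is jointly measurable in $x$ and the sample, and $$\mathbf E\big[\|\hat f_n-f\|_{P_X,2}^2\big]\le\inf_{\lambda^*}\Big\{\|f_{\lambda^*}-f\|_{P_X,2}^2+\frac{4\beta}{n+1}\sum_{j=1}^M\log\big(1+\tau^{-1}|\lambda_j^*|\big)\Big\}+4\tau^2M+\frac{\beta}{n+1},$$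 where the infimum is over all $\lambda^*\in\mathbb R^M$ with $\|\lambda^*\|_1\le R-2M\tau$ (and is $+\infty$ if there is no such $\lambda^*$). -/

import Mathlib

open MeasureTheory ProbabilityTheory
open scoped ENNReal

noncomputable section

namespace MirrorAveraging

/-- The linear combination `f_w = ∑ j, w j • φ j` of the functions of the dictionary `φ`. -/
def linComb {𝒳 : Type*} {M : ℕ} (φ : Fin M → 𝒳 → ℝ) (w : Fin M → ℝ) (x : 𝒳) : ℝ :=
  ∑ j, w j * φ j x

/-- The `ℓ₁`-norm on `ℝ^M`. -/
def l1norm {M : ℕ} (w : Fin M → ℝ) : ℝ := ∑ j, |w j|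

/-- The closed `ℓ₁`-ball `{w ∈ ℝ^M : ‖w‖₁ ≤ R}`, which is the parameter set `Λ`. -/
def l1ball (M : ℕ) (R : ℝ) : Set (Fin M → ℝ) := {w | l1norm w ≤ R}

/-- The unnormalized density `∏ j, (τ² + w_j²)⁻²`. -/
def priorWeight {M : ℕ} (τ : ℝ) (w : Fin M → ℝ) : ℝ := ∏ j, ((τ ^ 2 + w j ^ 2) ^ 2)⁻¹

/-- The normalizing constant of the sparsity prior. -/
def priorConst (M : ℕ) (τ R : ℝ) : ℝ := ∫ w in l1ball M R, priorWeight τ w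

/-- The sparsity prior: the law on `ℝ^M` with Lebesgue density
`(1 / C) ∏ j, (τ² + w_j²)⁻² 1(‖w‖₁ ≤ R)`. -/
def sparsityPrior (M : ℕ) (τ R : ℝ) : Measure (Fin M → ℝ) :=
  (volume.restrict (l1ball M R)).withDensity
    (fun w => ENNReal.ofReal (priorWeight τ w / priorConst M τ R))

/-- The squared loss contrast `Q(z, g) = (y - g x)²` for `z = (x, y)`. -/
def contrast {𝒳 : Type*} (z : 𝒳 × ℝ) (g : 𝒳 → ℝ) : ℝ := (z.2 - g z.1) ^ 2

/-- `exp (-(1/β) ∑_{i ≤ m} Q(Z_i, f_w))`, the sum being over the first `m` observations. -/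
def expWeight {𝒳 : Type*} {M n : ℕ} (φ : Fin M → 𝒳 → ℝ) (β : ℝ)
    (Z : Fin n → 𝒳 × ℝ) (m : ℕ) (w : Fin M → ℝ) : ℝ :=
  Real.exp (-(1 / β) * ∑ i : Fin n, if (i : ℕ) < m then contrast (Z i) (linComb φ w) else 0)

/-- The density `θ̂_{m,w}(Z)` with respect to the prior `π` (equal to `1` for `m = 0` when `π` is a
probability measure). -/
def posteriorDensityStep {𝒳 : Type*} {M n : ℕ} (φ : Fin M → 𝒳 → ℝ) (β : ℝ)
    (π : Measure (Fin M → ℝ)) (Z : Fin n → 𝒳 × ℝ) (m : ℕ) (w : Fin M → ℝ) : ℝ :=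
  expWeight φ β Z m w / ∫ v, expWeight φ β Z m v ∂π

/-- The averaged posterior density `θ̂_w(Z) = (1/(n+1)) ∑_{m=0}^n θ̂_{m,w}(Z)`. -/
def posteriorDensity {𝒳 : Type*} {M n : ℕ} (φ : Fin M → 𝒳 → ℝ) (β : ℝ)
    (π : Measure (Fin M → ℝ)) (Z : Fin n → 𝒳 × ℝ) (w : Fin M → ℝ) : ℝ :=
  (1 / ((n : ℝ) + 1)) * ∑ m ∈ Finset.range (n + 1), posteriorDensityStep φ β π Z m w

/-- The mirror averaging aggregate `f̂_n(Z, x) = ∫ f_w(x) θ̂_w(Z) π(dw)`. -/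
def maAggregate {𝒳 : Type*} {M n : ℕ} (φ : Fin M → 𝒳 → ℝ) (β : ℝ)
    (π : Measure (Fin M → ℝ)) (Z : Fin n → 𝒳 × ℝ) (x : 𝒳) : ℝ :=
  ∫ w, linComb φ w x * posteriorDensity φ β π Z w ∂π

/-- `f` is (a version of) the regression function `f(x) = E(Y | X = x)` of a pair `(X, Y)` with
law `P` and integrable `Y`; `P.condKernel x` is the conditional law of `Y` given `X = x`. -/
def IsRegressionFunction {𝒳 : Type*} [MeasurableSpace 𝒳] (P : Measure (𝒳 × ℝ))
    [IsFiniteMeasure P] (f : 𝒳 → ℝ) : Prop :=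
  Measurable f ∧ Integrable (fun z : 𝒳 × ℝ => z.2) P ∧
    ∀ᵐ x ∂P.fst, f x = ∫ y, y ∂(P.condKernel x)

/-- The conditional exponential moment condition on the error `ξ = Y - f(X)`:
`P_X`-almost surely, `E(exp (t ξ) | X) ≤ exp (σ² t² / 2)` for all `|t| ≤ b`. -/
def CondExpMoment {𝒳 : Type*} [MeasurableSpace 𝒳] (P : Measure (𝒳 × ℝ))
    [IsFiniteMeasure P] (f : 𝒳 → ℝ) (σ b : ℝ) : Prop :=
  ∀ᵐ x ∂P.fst, ∀ t : ℝ, |t| ≤ b →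
    ∫⁻ y, ENNReal.ofReal (Real.exp (t * (y - f x))) ∂(P.condKernel x) ≤
      ENNReal.ofReal (Real.exp (σ ^ 2 * t ^ 2 / 2))

/-- The integrated squared loss `ℓ(g, f) = ‖g - f‖²` in `L²(ν)`. -/
def sqLoss {𝒳 : Type*} [MeasurableSpace 𝒳] (ν : Measure 𝒳) (g f : 𝒳 → ℝ) : ℝ≥0∞ :=
  eLpNorm (fun x => g x - f x) 2 ν ^ 2

end MirrorAveraging

end

open MirrorAveraging

noncomputable section

namespace MirrorAveraging

/-! ### One-dimensional integrals of the prior density, and their products. -/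

section Weight

variable {τ : ℝ}

/-! The aggregate is the average of the posterior means after m = 0, …, n observations, so by
convexity of the square its loss is at most the average of their losses. The point is that each
posterior mean pays for its risk with a drop of the log-partition function.

Fix a posterior θ with mean regressor g and a fresh observation z. Under the temperature condition
the squared loss is exponentially concave on average over the noise: given the design, E[exp((y -
g(x))²/β) ∫ exp(-(y - f_w(x))²/β) θ(dw)] ≤ 1. This is Fubini, the moment condition and Jensen for an
explicit concave function (`concaveOn_exp_neg_sq`, `lintegral_mixture_le`). Since log u ≤ u - 1, the
prediction risk of g is at most -β times the expected log of the mixture (`Admissible.one_step`).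
For θ the posterior after k observations, that mixture is the ratio of partition functions k + 1 and
k. Adding a ghost observation to the sample and summing over k telescopes to -β E log of the
partition function of n + 1 observations (`Admissible.sum_posteriorLoss_le`).

That free energy is bounded by testing it against the prior of radius 2Mτ translated to the
comparison vector v. The heavy-tailed weight changes under translation only by a factor polynomial
in |v_j|/τ, whence the logarithmic price (`lintegral_translate_le`, `log_integral_exp_ge`). The
translated prior is symmetric about v with coordinate variances at most 2τ², so averaging the loss
over it adds at most 2τ²M per observation (`Admissible.neg_integral_log_partition_le`). The noise
variance cancels, and dividing by n + 1 gives the bound. -/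

lemma continuous_inv_sq_add_sq (hτ : 0 < τ) : Continuous fun t : ℝ => ((τ ^ 2 + t ^ 2) ^ 2)⁻¹ := by
  refine Continuous.inv₀ (by fun_prop) fun t => ?_
  positivity

lemma integrable_inv_add_sq (hτ : 0 < τ) : Integrable fun t : ℝ => (τ ^ 2 + t ^ 2)⁻¹ := by
  refine (integrable_inv_one_add_sq.const_mul (1 + (τ ^ 2)⁻¹)).mono' ?_ (.of_forall fun t => ?_)
  · refine Continuous.aestronglyMeasurable (Continuous.inv₀ (by fun_prop) fun t => ?_)
    positivity
  · rw [Real.norm_of_nonneg (by positivity), ← div_eq_mul_inv, inv_eq_one_div,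
      div_le_div_iff₀ (by positivity) (by positivity)]
    have : (τ ^ 2)⁻¹ * τ ^ 2 = 1 := inv_mul_cancel₀ (by positivity)
    have h2 : 0 ≤ (τ ^ 2)⁻¹ * t ^ 2 := by positivity
    nlinarith [sq_nonneg τ]

lemma integrable_inv_sq_add_sq (hτ : 0 < τ) :
    Integrable fun t : ℝ => ((τ ^ 2 + t ^ 2) ^ 2)⁻¹ := by
  refine ((integrable_inv_add_sq hτ).const_mul (τ ^ 2)⁻¹).mono'
    (continuous_inv_sq_add_sq hτ).aestronglyMeasurable (.of_forall fun t => ?_)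
  rw [Real.norm_of_nonneg (by positivity), ← mul_inv]
  refine inv_anti₀ (by positivity) ?_
  nlinarith [sq_nonneg τ, mul_nonneg (sq_nonneg t) (add_nonneg (sq_nonneg τ) (sq_nonneg t))]

lemma integrable_sq_mul_inv_sq_add_sq (hτ : 0 < τ) :
    Integrable fun t : ℝ => t ^ 2 * ((τ ^ 2 + t ^ 2) ^ 2)⁻¹ := by
  refine (integrable_inv_add_sq hτ).mono'
    ((continuous_pow 2).mul (continuous_inv_sq_add_sq hτ)).aestronglyMeasurable
    (.of_forall fun t => ?_)
  rw [Real.norm_of_nonneg (by positivity), ← div_eq_mul_inv, inv_eq_one_div,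
    div_le_div_iff₀ (by positivity) (by positivity)]
  nlinarith [mul_nonneg (sq_nonneg τ) (add_nonneg (sq_nonneg τ) (sq_nonneg t))]

lemma integral_sq_mul_inv_sq_add_sq (hτ : 0 < τ) :
    ∫ t : ℝ, t ^ 2 * ((τ ^ 2 + t ^ 2) ^ 2)⁻¹ = τ ^ 2 * ∫ t : ℝ, ((τ ^ 2 + t ^ 2) ^ 2)⁻¹ := by
  have h1 := (integrable_inv_sq_add_sq hτ).const_mul (τ ^ 2)
  have h2 := integrable_sq_mul_inv_sq_add_sq hτ
  have hlim : ∀ l : Filter ℝ, Filter.Tendsto (fun t : ℝ => t ^ 2) l Filter.atTop →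
      Filter.Tendsto (fun t : ℝ => t / (τ ^ 2 + t ^ 2)) l (nhds 0) := by
    intro l hl
    have hb : Filter.Tendsto (fun t : ℝ => |t|⁻¹) l (nhds 0) := by
      refine Filter.Tendsto.inv_tendsto_atTop ?_
      have := Real.tendsto_sqrt_atTop.comp hl
      simpa [Function.comp_def, Real.sqrt_sq_eq_abs] using this
    refine squeeze_zero_norm (fun t => ?_) hb
    rw [Real.norm_eq_abs, abs_div, abs_of_pos (show 0 < τ ^ 2 + t ^ 2 by positivity)]
    rcases eq_or_ne t 0 with rfl | ht
    · simp
    rw [inv_eq_one_div, div_le_div_iff₀ (by positivity) (abs_pos.2 ht), ← sq, sq_abs]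
    nlinarith [sq_nonneg τ]
  -- The primitive t / (τ² + t²) vanishes at both ends, and its derivative is the difference of the
  -- two integrands.
  have key := integral_of_hasDerivAt_of_tendsto (f := fun t : ℝ => t / (τ ^ 2 + t ^ 2))
    (f' := fun t => τ ^ 2 * ((τ ^ 2 + t ^ 2) ^ 2)⁻¹ - t ^ 2 * ((τ ^ 2 + t ^ 2) ^ 2)⁻¹)
    (m := 0) (n := 0) (fun t => ?_) (h1.sub h2) (hlim _ ?_) (hlim _ ?_)
  · rw [integral_sub h1 h2, integral_const_mul] at key
    linarith
  · have hne : τ ^ 2 + t ^ 2 ≠ 0 := by positivity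
    refine ((hasDerivAt_id' t).fun_div ((hasDerivAt_pow 2 t).const_add (τ ^ 2)) hne).congr_deriv ?_
    field_simp
    ring
  · exact (Filter.tendsto_pow_atTop two_ne_zero).comp Filter.tendsto_neg_atBot_atTop |>.congr
      fun t => by simp
  · exact Filter.tendsto_pow_atTop two_ne_zero

variable {M : ℕ}

lemma priorWeight_pos (hτ : 0 < τ) (w : Fin M → ℝ) : 0 < priorWeight τ w :=
  Finset.prod_pos fun j _ => by positivity

lemma continuous_priorWeight (hτ : 0 < τ) : Continuous (priorWeight (M := M) τ) :=
  continuous_finsetProd _ fun j _ => (continuous_inv_sq_add_sq hτ).comp (continuous_apply j)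

lemma integrable_priorWeight (hτ : 0 < τ) : Integrable (priorWeight (M := M) τ) :=
  Integrable.fintype_prod fun _ => integrable_inv_sq_add_sq hτ

/-- Keeps the integrand a product of one-variable functions, so that Fubini reduces the second
moment to one dimension. -/
lemma sq_mul_priorWeight (j : Fin M) (w : Fin M → ℝ) :
    w j ^ 2 * priorWeight τ w =
      ∏ i, (fun t : ℝ => (if i = j then t ^ 2 else 1) * ((τ ^ 2 + t ^ 2) ^ 2)⁻¹) (w i) := by
  simp only [Finset.prod_mul_distrib, priorWeight]
  simp

lemma integrable_sq_mul_priorWeight (hτ : 0 < τ) (j : Fin M) :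
    Integrable fun w : Fin M → ℝ => w j ^ 2 * priorWeight τ w := by
  simp only [sq_mul_priorWeight]
  refine Integrable.fintype_prod (f := fun i t => (if i = j then t ^ 2 else 1) *
    ((τ ^ 2 + t ^ 2) ^ 2)⁻¹) fun i => ?_
  by_cases hij : i = j
  · simpa [hij] using integrable_sq_mul_inv_sq_add_sq hτ
  · simpa [hij] using integrable_inv_sq_add_sq hτ

lemma integral_sq_mul_priorWeight (hτ : 0 < τ) (j : Fin M) :
    ∫ w : Fin M → ℝ, w j ^ 2 * priorWeight τ w = τ ^ 2 * ∫ w : Fin M → ℝ, priorWeight τ w := by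
  have h : ∀ i : Fin M, ∫ t : ℝ, (if i = j then t ^ 2 else 1) * ((τ ^ 2 + t ^ 2) ^ 2)⁻¹ =
      (if i = j then τ ^ 2 else 1) * ∫ t : ℝ, ((τ ^ 2 + t ^ 2) ^ 2)⁻¹ := by
    intro i
    by_cases hij : i = j
    · simpa [hij] using integral_sq_mul_inv_sq_add_sq hτ
    · simp [hij]
  simp only [sq_mul_priorWeight]
  rw [integral_fintype_prod_volume_eq_prod
    (fun i t => (if i = j then t ^ 2 else 1) * ((τ ^ 2 + t ^ 2) ^ 2)⁻¹)]
  unfold priorWeight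
  rw [integral_fintype_prod_volume_eq_prod (fun (_ : Fin M) (t : ℝ) => ((τ ^ 2 + t ^ 2) ^ 2)⁻¹)]
  simp only [h, Finset.prod_mul_distrib]
  simp

end Weight

/-! ### The ℓ₁-ball and the mass it carries. -/

section Ball

variable {M : ℕ} {R τ : ℝ}

lemma continuous_l1norm : Continuous (l1norm (M := M)) := by
  unfold l1norm
  fun_prop

lemma isClosed_l1ball : IsClosed (l1ball M R) := isClosed_le continuous_l1norm continuous_const

lemma measurableSet_l1ball : MeasurableSet (l1ball M R) := isClosed_l1ball.measurableSet

lemma abs_le_of_mem_l1ball {w : Fin M → ℝ} (hw : w ∈ l1ball M R) (j : Fin M) : |w j| ≤ R :=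
  (Finset.single_le_sum (f := fun j => |w j|) (fun _ _ => abs_nonneg _) (Finset.mem_univ j)).trans
    hw

lemma isCompact_l1ball : IsCompact (l1ball M R) := by
  refine (isCompact_Icc (a := fun _ : Fin M => -R) (b := fun _ => R)).of_isClosed_subset
    isClosed_l1ball fun w hw => ?_
  exact ⟨fun j => (abs_le.1 (abs_le_of_mem_l1ball hw j)).1,
    fun j => (abs_le.1 (abs_le_of_mem_l1ball hw j)).2⟩

lemma volume_l1ball_pos (hR : 0 < R) : 0 < volume (l1ball M R) := by
  have ho : IsOpen {w : Fin M → ℝ | l1norm w < R} := isOpen_lt continuous_l1norm continuous_const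
  refine (ho.measure_pos volume ⟨0, by simpa [l1norm] using hR⟩).trans_le (measure_mono ?_)
  exact fun w (hw : l1norm w < R) => hw.le

lemma priorConst_pos (hτ : 0 < τ) (hR : 0 < R) : 0 < priorConst M τ R := by
  unfold priorConst
  rw [setIntegral_pos_iff_support_of_nonneg_ae
    (.of_forall fun w => (priorWeight_pos hτ w).le) (integrable_priorWeight hτ).integrableOn]
  have : Function.support (priorWeight (M := M) τ) = Set.univ :=
    Set.eq_univ_of_forall fun w => (priorWeight_pos hτ w).ne'
  rw [this, Set.univ_inter]
  exact volume_l1ball_pos hR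

lemma priorConst_le (hτ : 0 < τ) : priorConst M τ R ≤ ∫ w : Fin M → ℝ, priorWeight τ w :=
  setIntegral_le_integral (integrable_priorWeight hτ) (.of_forall fun w => (priorWeight_pos hτ w).le)

/-- Chebyshev's inequality for the product density: the ball of radius `2Mτ` carries at least half
of its mass. -/
lemma integral_priorWeight_le (hτ : 0 < τ) (hM : 0 < M) :
    ∫ w : Fin M → ℝ, priorWeight τ w ≤ 2 * priorConst M τ (2 * M * τ) := by
  set S := l1ball M (2 * M * τ)
  have hM' : (0 : ℝ) < M := by exact_mod_cast hM
  have hsq : Integrable fun w : Fin M → ℝ => ∑ j, w j ^ 2 * priorWeight τ w :=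
    integrable_finsetSum _ fun j _ => integrable_sq_mul_priorWeight hτ j
  -- Outside the ball, Cauchy–Schwarz gives ∑ v_j² ≥ 4Mτ², so the indicator is dominated by the
  -- normalized sum of squares.
  have hcompl : ∫ w in Sᶜ, priorWeight τ w ≤
      ∫ w : Fin M → ℝ, (4 * M * τ ^ 2)⁻¹ * ∑ j, w j ^ 2 * priorWeight τ w := by
    rw [← integral_indicator measurableSet_l1ball.compl]
    refine integral_mono ((integrable_priorWeight hτ).indicator measurableSet_l1ball.compl)
      (hsq.const_mul _) fun w => ?_
    have hpos := priorWeight_pos hτ w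
    refine Set.indicator_le' (f := priorWeight τ)
      (g := fun v => (4 * M * τ ^ 2)⁻¹ * ∑ j, v j ^ 2 * priorWeight τ v)
      (fun v hv => ?_) (fun v _ => ?_) w
    · have hv' : 2 * M * τ < l1norm v := not_le.1 hv
      have h1 : (l1norm v) ^ 2 ≤ M * ∑ j, v j ^ 2 := by
        have := sq_sum_le_card_mul_sum_sq (s := (Finset.univ : Finset (Fin M)))
          (f := fun j => |v j|)
        simpa [l1norm] using this
      have h2 : (2 * M * τ) ^ 2 ≤ (l1norm v) ^ 2 := by gcongr
      have h3 : 4 * M * τ ^ 2 ≤ ∑ j, v j ^ 2 := by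
        refine le_of_mul_le_mul_left ?_ hM'
        linarith [show (2 * M * τ) ^ 2 = M * (4 * M * τ ^ 2) by ring]
      rw [← Finset.sum_mul, ← mul_assoc]
      refine le_mul_of_one_le_left (priorWeight_pos hτ v).le ?_
      rwa [← div_eq_inv_mul, one_le_div (by positivity)]
    · exact mul_nonneg (by positivity)
        (Finset.sum_nonneg fun j _ => mul_nonneg (sq_nonneg _) (priorWeight_pos hτ v).le)
  -- M second moments, each τ² times the total mass, against 4Mτ²: the complement carries at most a
  -- quarter, so the factor 2 in the conclusion leaves room.
  have hval : ∫ w : Fin M → ℝ, (4 * M * τ ^ 2)⁻¹ * ∑ j, w j ^ 2 * priorWeight τ w =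
      1 / 4 * ∫ w : Fin M → ℝ, priorWeight τ w := by
    rw [integral_const_mul, integral_finsetSum _ fun j _ => integrable_sq_mul_priorWeight hτ j]
    simp only [integral_sq_mul_priorWeight hτ]
    simp only [Finset.sum_const, Finset.card_univ, Fintype.card_fin, nsmul_eq_mul]
    field_simp
  have hsplit := integral_add_compl (measurableSet_l1ball (M := M) (R := 2 * M * τ))
    (integrable_priorWeight hτ)
  have hnn : 0 ≤ ∫ w : Fin M → ℝ, priorWeight τ w :=
    integral_nonneg fun w => (priorWeight_pos hτ w).le
  change priorConst M τ (2 * M * τ) + ∫ w in Sᶜ, priorWeight τ w = _ at hsplit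
  linarith

end Ball

/-! ### The sparsity prior: symmetry, moments and translation. -/

section Prior

variable {M : ℕ} {R τ : ℝ}

lemma measurable_priorDensity (hτ : 0 < τ) :
    Measurable fun w : Fin M → ℝ => ENNReal.ofReal (priorWeight τ w / priorConst M τ R) :=
  ((continuous_priorWeight hτ).measurable.div_const _).ennreal_ofReal

lemma lintegral_sparsityPrior (hτ : 0 < τ) (hR : 0 < R) {F : (Fin M → ℝ) → ℝ≥0∞}
    (hF : Measurable F) :
    ∫⁻ w, F w ∂(sparsityPrior M τ R) = ENNReal.ofReal (priorConst M τ R)⁻¹ *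
      ∫⁻ w in l1ball M R, ENNReal.ofReal (priorWeight τ w) * F w := by
  rw [sparsityPrior, lintegral_withDensity_eq_lintegral_mul _ (measurable_priorDensity hτ) hF,
    ← lintegral_const_mul' _ _ ENNReal.ofReal_ne_top]
  refine lintegral_congr fun w => ?_
  rw [Pi.mul_apply, div_eq_inv_mul, ENNReal.ofReal_mul (inv_nonneg.2 (priorConst_pos hτ hR).le),
    mul_assoc]

lemma isProbabilityMeasure_sparsityPrior (hτ : 0 < τ) (hR : 0 < R) :
    IsProbabilityMeasure (sparsityPrior M τ R) := by
  have hC := priorConst_pos (M := M) hτ hR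
  constructor
  rw [← lintegral_one, lintegral_sparsityPrior hτ hR measurable_const]
  simp only [mul_one]
  rw [← ofReal_integral_eq_lintegral_ofReal (integrable_priorWeight hτ).integrableOn
    (.of_forall fun w => (priorWeight_pos hτ w).le), ← ENNReal.ofReal_mul (inv_nonneg.2 hC.le)]
  change ENNReal.ofReal ((priorConst M τ R)⁻¹ * priorConst M τ R) = 1
  rw [inv_mul_cancel₀ hC.ne', ENNReal.ofReal_one]

lemma ae_mem_l1ball : ∀ᵐ w ∂(sparsityPrior M τ R), w ∈ l1ball M R :=
  (withDensity_absolutelyContinuous _ _).ae_le (ae_restrict_mem measurableSet_l1ball)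

/-- The prior lives on a compact ball, where a continuous function is bounded. -/
lemma integrable_sparsityPrior_of_continuous (hτ : 0 < τ) (hR : 0 < R) {g : (Fin M → ℝ) → ℝ}
    (hg : Continuous g) : Integrable g (sparsityPrior M τ R) := by
  have := isProbabilityMeasure_sparsityPrior (M := M) hτ hR
  obtain ⟨C, hC⟩ := (isCompact_l1ball (M := M) (R := R)).exists_bound_of_continuousOn
    hg.continuousOn
  exact Integrable.of_bound hg.aestronglyMeasurable C (ae_mem_l1ball.mono hC)

lemma integral_sparsityPrior (hτ : 0 < τ) (hR : 0 < R) (g : (Fin M → ℝ) → ℝ) :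
    ∫ w, g w ∂(sparsityPrior M τ R) =
      (priorConst M τ R)⁻¹ * ∫ w in l1ball M R, priorWeight τ w * g w := by
  rw [sparsityPrior, integral_withDensity_eq_integral_toReal_smul (measurable_priorDensity hτ)
    (.of_forall fun _ => ENNReal.ofReal_lt_top), ← integral_const_mul]
  refine integral_congr_ae (.of_forall fun w => ?_)
  have := priorWeight_pos hτ w
  have := priorConst_pos (M := M) hτ hR
  simp only [smul_eq_mul]
  rw [ENNReal.toReal_ofReal (by positivity)]
  ring

/-- The sign change of the `j`-th coordinate. -/
def reflect (j : Fin M) (w : Fin M → ℝ) (i : Fin M) : ℝ := if i = j then -w i else w i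

lemma reflect_self (j : Fin M) (w : Fin M → ℝ) : reflect j w j = -w j := by simp [reflect]

lemma reflect_of_ne {i j : Fin M} (h : i ≠ j) (w : Fin M → ℝ) : reflect j w i = w i := by
  simp [reflect, h]

lemma measurePreserving_reflect (j : Fin M) :
    MeasurePreserving (reflect j) (volume : Measure (Fin M → ℝ)) volume := by
  refine volume_preserving_pi (f := fun i (t : ℝ) => if i = j then -t else t) fun i => ?_
  by_cases h : i = j
  · simpa [h] using Measure.measurePreserving_neg (volume : Measure ℝ)
  · simpa [h] using! MeasurePreserving.id (volume : Measure ℝ)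

lemma measurableEmbedding_reflect (j : Fin M) : MeasurableEmbedding (reflect j) := by
  have hinv : Function.Involutive (reflect j) := fun w => by
    ext i
    by_cases h : i = j <;> simp [reflect, h]
  exact (MeasurableEquiv.mk (hinv.toPerm _) (measurePreserving_reflect j).measurable
    (measurePreserving_reflect j).measurable).measurableEmbedding

lemma l1norm_reflect (j : Fin M) (w : Fin M → ℝ) : l1norm (reflect j w) = l1norm w := by
  refine Finset.sum_congr rfl fun i _ => ?_
  by_cases h : i = j <;> simp [reflect, h]

lemma priorWeight_reflect (j : Fin M) (w : Fin M → ℝ) :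
    priorWeight τ (reflect j w) = priorWeight τ w := by
  refine Finset.prod_congr rfl fun i _ => ?_
  by_cases h : i = j <;> simp [reflect, h]

/-- The ball, the weight and Lebesgue measure are all invariant under a sign change; this makes
first moments and mixed second moments vanish. -/
lemma integral_reflect (hτ : 0 < τ) (hR : 0 < R) (j : Fin M) (g : (Fin M → ℝ) → ℝ) :
    ∫ w, g (reflect j w) ∂(sparsityPrior M τ R) = ∫ w, g w ∂(sparsityPrior M τ R) := by
  rw [integral_sparsityPrior hτ hR, integral_sparsityPrior hτ hR]
  congr 1
  rw [← (measurePreserving_reflect j).setIntegral_preimage_emb (measurableEmbedding_reflect j)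
    fun w => priorWeight τ w * g w]
  have : reflect j ⁻¹' l1ball M R = l1ball M R := by
    ext w
    simp [l1ball, l1norm_reflect]
  simp only [this, priorWeight_reflect]

lemma integral_coord_eq_zero (hτ : 0 < τ) (hR : 0 < R) (j : Fin M) :
    ∫ w, w j ∂(sparsityPrior M τ R) = 0 := by
  have := integral_reflect hτ hR j fun w => w j
  simp only [reflect_self, integral_neg] at this
  linarith

lemma integral_coord_mul_coord_eq_zero (hτ : 0 < τ) (hR : 0 < R) {i j : Fin M} (hij : i ≠ j) :
    ∫ w, w i * w j ∂(sparsityPrior M τ R) = 0 := by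
  have := integral_reflect hτ hR j fun w => w i * w j
  simp only [reflect_self, reflect_of_ne hij, mul_neg, integral_neg] at this
  linarith

/-- Truncation can only decrease the unnormalized second moment, while normalization costs at most
the factor 2 of `integral_priorWeight_le`. -/
lemma integral_coord_sq_le (hτ : 0 < τ) (hM : 0 < M) (j : Fin M) :
    ∫ w, w j ^ 2 ∂(sparsityPrior M τ (2 * M * τ)) ≤ 2 * τ ^ 2 := by
  have hM' : (0 : ℝ) < M := by exact_mod_cast hM
  have hR : 0 < 2 * M * τ := by positivity
  have hC := priorConst_pos (M := M) hτ hR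
  rw [integral_sparsityPrior hτ hR, inv_mul_le_iff₀ hC]
  calc ∫ w in l1ball M (2 * M * τ), priorWeight τ w * w j ^ 2
      ≤ ∫ w : Fin M → ℝ, priorWeight τ w * w j ^ 2 := by
        refine setIntegral_le_integral ?_ (.of_forall fun w => ?_)
        · simpa [mul_comm] using integrable_sq_mul_priorWeight hτ j
        · exact mul_nonneg (priorWeight_pos hτ w).le (sq_nonneg _)
    _ = τ ^ 2 * ∫ w : Fin M → ℝ, priorWeight τ w := by
        simpa [mul_comm] using integral_sq_mul_priorWeight hτ j
    _ ≤ τ ^ 2 * (2 * priorConst M τ (2 * M * τ)) := by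
        gcongr
        exact integral_priorWeight_le hτ hM
    _ = _ := by ring

/-- After expansion of the square, symmetry kills the linear and the off-diagonal terms. -/
lemma integral_add_linear_sq (hτ : 0 < τ) (hR : 0 < R) (c : ℝ) (a : Fin M → ℝ) :
    ∫ w, (c + ∑ j, w j * a j) ^ 2 ∂(sparsityPrior M τ R) =
      c ^ 2 + ∑ j, a j ^ 2 * ∫ w, w j ^ 2 ∂(sparsityPrior M τ R) := by
  have := isProbabilityMeasure_sparsityPrior (M := M) hτ hR
  have hint : ∀ {g : (Fin M → ℝ) → ℝ}, Continuous g → Integrable g (sparsityPrior M τ R) :=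
    fun hg => integrable_sparsityPrior_of_continuous hτ hR hg
  have hexp : ∀ w : Fin M → ℝ, (c + ∑ j, w j * a j) ^ 2 =
      c ^ 2 + (2 * c * ∑ j, w j * a j + ∑ i, ∑ j, a i * a j * (w i * w j)) := by
    intro w
    have : (∑ j, w j * a j) ^ 2 = ∑ i, ∑ j, a i * a j * (w i * w j) := by
      rw [sq, Finset.sum_mul_sum]
      exact Finset.sum_congr rfl fun i _ => Finset.sum_congr rfl fun j _ => by ring
    rw [← this]
    ring
  simp only [hexp]
  rw [integral_add (hint (by fun_prop)) (hint (by fun_prop)),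
    integral_add (hint (by fun_prop)) (hint (by fun_prop)), integral_const_mul,
    integral_finsetSum _ fun j _ => hint (by fun_prop),
    integral_finsetSum _ fun j _ => hint (by fun_prop)]
  simp only [integral_mul_const, integral_coord_eq_zero hτ hR]
  have : ∀ i : Fin M, ∫ w, ∑ j, a i * a j * (w i * w j) ∂(sparsityPrior M τ R) =
      a i ^ 2 * ∫ w, w i ^ 2 ∂(sparsityPrior M τ R) := by
    intro i
    rw [integral_finsetSum _ fun j _ => hint (by fun_prop), Finset.sum_eq_single i]
    · rw [integral_const_mul]
      simp only [sq]
    · intro j _ hj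
      rw [integral_const_mul, integral_coord_mul_coord_eq_zero hτ hR hj.symm, mul_zero]
    · simp
  simp [this]

/-- The logarithm of the density of the translated prior is at most this constant. -/
def transCost (τ : ℝ) (v : Fin M → ℝ) : ℝ := 4 * ∑ j, Real.log (1 + τ⁻¹ * |v j|) + 1

/-- With r = |s|/τ, the cross term 2τr|t| is absorbed by r(τ² + t²). -/
lemma sq_add_sq_add_le (hτ : 0 < τ) (t s : ℝ) :
    τ ^ 2 + (t + s) ^ 2 ≤ (τ ^ 2 + t ^ 2) * (1 + τ⁻¹ * |s|) ^ 2 := by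
  have h1 : (t + s) ^ 2 ≤ (|t| + |s|) ^ 2 := sq_le_sq' (by
    linarith [neg_abs_le t, neg_abs_le s]) (by linarith [le_abs_self t, le_abs_self s])
  rw [← sq_abs t]
  obtain ⟨r, hr, hs⟩ : ∃ r : ℝ, 0 ≤ r ∧ |s| = τ * r :=
    ⟨τ⁻¹ * |s|, by positivity, by field_simp⟩
  rw [hs] at h1 ⊢
  rw [inv_mul_cancel_left₀ hτ.ne']
  nlinarith [mul_nonneg hr (sq_nonneg (τ - |t|)), mul_nonneg hr (sq_nonneg (|t|)),
    mul_nonneg hr (sq_nonneg τ), mul_nonneg (mul_nonneg hr hr) (sq_nonneg (|t|)), abs_nonneg t]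

/-- Polynomial tails make the density ratio polynomial; the exponent 4 comes from squaring
`sq_add_sq_add_le` in each coordinate. -/
lemma priorWeight_le_translate (hτ : 0 < τ) (w v : Fin M → ℝ) :
    priorWeight τ w ≤ Real.exp (4 * ∑ j, Real.log (1 + τ⁻¹ * |v j|)) * priorWeight τ (w + v) := by
  have : Real.exp (4 * ∑ j, Real.log (1 + τ⁻¹ * |v j|)) = ∏ j, (1 + τ⁻¹ * |v j|) ^ 4 := by
    rw [Finset.mul_sum, Real.exp_sum]
    refine Finset.prod_congr rfl fun j _ => ?_
    have hp : 0 < 1 + τ⁻¹ * |v j| := by positivity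
    rw [show (4 : ℝ) * Real.log (1 + τ⁻¹ * |v j|) = ((4 : ℕ) : ℝ) * Real.log (1 + τ⁻¹ * |v j|) by
      norm_num, Real.exp_nat_mul, Real.exp_log hp]
  rw [this, priorWeight, priorWeight, ← Finset.prod_mul_distrib]
  refine Finset.prod_le_prod (fun j _ => by positivity) fun j _ => ?_
  have h := sq_add_sq_add_le hτ (w j) (v j)
  rw [Pi.add_apply, inv_eq_one_div, ← div_eq_mul_inv, div_le_div_iff₀ (by positivity)
    (by positivity), one_mul]
  calc (τ ^ 2 + (w j + v j) ^ 2) ^ 2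
      ≤ ((τ ^ 2 + w j ^ 2) * (1 + τ⁻¹ * |v j|) ^ 2) ^ 2 := by gcongr
    _ = _ := by ring

lemma l1norm_add_le (w v : Fin M → ℝ) : l1norm (w + v) ≤ l1norm w + l1norm v := by
  rw [l1norm, l1norm, l1norm, ← Finset.sum_add_distrib]
  exact Finset.sum_le_sum fun j _ => abs_add_le _ _

/-- The prior on the ball of radius `2Mτ`, translated by `v`, is dominated by the prior on the
ball of radius `R`, with density at most `exp (transCost τ v)`. -/
lemma lintegral_translate_le (hτ : 0 < τ) (hM : 0 < M) {v : Fin M → ℝ}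
    (hR : 0 < R) (hv : l1norm v ≤ R - 2 * M * τ)
    {F : (Fin M → ℝ) → ℝ≥0∞} (hF : Measurable F) :
    ∫⁻ w, F (w + v) ∂(sparsityPrior M τ (2 * M * τ)) ≤
      ENNReal.ofReal (Real.exp (transCost τ v)) * ∫⁻ w, F w ∂(sparsityPrior M τ R) := by
  have hM' : (0 : ℝ) < M := by exact_mod_cast hM
  have hr : 0 < 2 * M * τ := by positivity
  have hC0 := priorConst_pos (M := M) hτ hr
  have hC := priorConst_pos (M := M) hτ hR
  set E := Real.exp (4 * ∑ j, Real.log (1 + τ⁻¹ * |v j|)) with hE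
  -- The ratio of the normalizing constants is at most 2 ≤ e, which is the summand 1 in `transCost`.
  have hconst : (priorConst M τ (2 * M * τ))⁻¹ * E ≤
      Real.exp (transCost τ v) * (priorConst M τ R)⁻¹ := by
    rw [transCost, Real.exp_add, ← hE]
    have h2 : (2 : ℝ) ≤ Real.exp 1 := by linarith [Real.add_one_le_exp (1 : ℝ)]
    have h3 : priorConst M τ R ≤ Real.exp 1 * priorConst M τ (2 * M * τ) :=
      (priorConst_le hτ).trans ((integral_priorWeight_le hτ hM).trans (by gcongr))
    have hEp : 0 < E := Real.exp_pos _
    rw [← div_eq_inv_mul, ← div_eq_mul_inv, div_le_div_iff₀ hC0 hC]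
    calc E * priorConst M τ R ≤ E * (Real.exp 1 * priorConst M τ (2 * M * τ)) := by gcongr
      _ = _ := by ring
  rw [lintegral_sparsityPrior hτ hr (F := fun w => F (w + v)) (hF.comp (measurable_add_const v)),
    lintegral_sparsityPrior hτ hR hF]
  -- Lebesgue measure is translation invariant, and the condition on `v` is what keeps the
  -- translated small ball inside the large one.
  have hstep : ∫⁻ w in l1ball M (2 * M * τ), ENNReal.ofReal (priorWeight τ w) * F (w + v) ≤
      ENNReal.ofReal E * ∫⁻ w in l1ball M R, ENNReal.ofReal (priorWeight τ w) * F w := by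
    rw [← lintegral_indicator measurableSet_l1ball, ← lintegral_indicator measurableSet_l1ball,
      ← lintegral_add_right_eq_self
        ((l1ball M R).indicator fun w => ENNReal.ofReal (priorWeight τ w) * F w) v, ← lintegral_const_mul' _ _ ENNReal.ofReal_ne_top]
    refine lintegral_mono fun w => ?_
    by_cases hw : w ∈ l1ball M (2 * M * τ)
    · have hwv : w + v ∈ l1ball M R := by
        have h1 : l1norm w ≤ 2 * M * τ := hw
        exact (l1norm_add_le w v).trans (by linarith)
      rw [Set.indicator_of_mem hw, Set.indicator_of_mem hwv, ← mul_assoc,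
        ← ENNReal.ofReal_mul (Real.exp_pos _).le]
      gcongr
      exact priorWeight_le_translate hτ w v
    · rw [Set.indicator_of_notMem hw]
      exact zero_le
  calc _ ≤ ENNReal.ofReal (priorConst M τ (2 * M * τ))⁻¹ * (ENNReal.ofReal E *
        ∫⁻ w in l1ball M R, ENNReal.ofReal (priorWeight τ w) * F w) := by gcongr
    _ ≤ _ := by
      rw [← mul_assoc, ← mul_assoc, ← ENNReal.ofReal_mul (inv_nonneg.2 hC0.le),
        ← ENNReal.ofReal_mul (Real.exp_pos _).le]
      gcongr

/-- A lower bound of Donsker–Varadhan type for the log-partition function of the prior. -/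
lemma log_integral_exp_ge (hτ : 0 < τ) (hM : 0 < M) {v : Fin M → ℝ}
    (hR : 0 < R) (hv : l1norm v ≤ R - 2 * M * τ) {G : (Fin M → ℝ) → ℝ} (hG : Continuous G) :
    -transCost τ v - ∫ w, G (w + v) ∂(sparsityPrior M τ (2 * M * τ)) ≤
      Real.log (∫ w, Real.exp (-G w) ∂(sparsityPrior M τ R)) := by
  have hM' : (0 : ℝ) < M := by exact_mod_cast hM
  have hr : 0 < 2 * M * τ := by positivity
  have := isProbabilityMeasure_sparsityPrior (M := M) hτ hr
  have := isProbabilityMeasure_sparsityPrior (M := M) hτ hR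
  set p := sparsityPrior M τ (2 * M * τ)
  set c := ∫ w, G (w + v) ∂p
  have hGv : Integrable (fun w => G (w + v)) p :=
    integrable_sparsityPrior_of_continuous hτ hr (by fun_prop)
  have he : Integrable (fun w => Real.exp (-G w)) (sparsityPrior M τ R) :=
    integrable_sparsityPrior_of_continuous hτ hR (by fun_prop)
  have hev : Integrable (fun w => Real.exp (-G (w + v))) p :=
    integrable_sparsityPrior_of_continuous hτ hr (by fun_prop)
  -- Jensen by hand: integrate the tangent line of the exponential at `-c`.
  have hjensen : Real.exp (-c) ≤ ∫ w, Real.exp (-G (w + v)) ∂p := by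
    have hi : Integrable (fun w => Real.exp (-c) * (1 + c - G (w + v))) p :=
      ((integrable_const _).sub hGv).const_mul _
    have h1 : ∫ w, Real.exp (-c) * (1 + c - G (w + v)) ∂p = Real.exp (-c) := by
      rw [integral_const_mul, integral_sub (integrable_const _) hGv]
      simp [c]
    rw [← h1]
    refine integral_mono hi hev fun w => ?_
    have h2 := Real.add_one_le_exp (c - G (w + v))
    calc Real.exp (-c) * (1 + c - G (w + v)) ≤ Real.exp (-c) * Real.exp (c - G (w + v)) := by
          gcongr
          linarith
      _ = _ := by
          rw [← Real.exp_add]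
          ring_nf
  have hdom : ∫ w, Real.exp (-G (w + v)) ∂p ≤
      Real.exp (transCost τ v) * ∫ w, Real.exp (-G w) ∂(sparsityPrior M τ R) := by
    have h := lintegral_translate_le (R := R) hτ hM hR hv
      (F := fun w => ENNReal.ofReal (Real.exp (-G w))) (by fun_prop)
    rw [← ofReal_integral_eq_lintegral_ofReal hev (.of_forall fun w => (Real.exp_pos _).le),
      ← ofReal_integral_eq_lintegral_ofReal he (.of_forall fun w => (Real.exp_pos _).le),
      ← ENNReal.ofReal_mul (Real.exp_pos _).le] at h
    exact (ENNReal.ofReal_le_ofReal_iff (mul_nonneg (Real.exp_pos _).le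
      (integral_nonneg fun w => (Real.exp_pos _).le))).1 h
  have hlow : Real.exp (-transCost τ v - c) ≤ ∫ w, Real.exp (-G w) ∂(sparsityPrior M τ R) := by
    rw [sub_eq_add_neg, Real.exp_add, Real.exp_neg (transCost τ v),
      inv_mul_le_iff₀ (Real.exp_pos _)]
    exact hjensen.trans hdom
  exact (Real.le_log_iff_exp_le ((Real.exp_pos _).trans_le hlow)).2 hlow

end Prior

/-! ### The concave function behind the temperature condition. -/

section Concavity

/-- For the exponent q, concavity of exp q means q'² + q'' ≤ 0. Here q'' = -2(β - 2σ²)/β² and q'² ≤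
4L²/β² on the interval, so the condition on β is exactly what this estimate needs. -/
lemma concaveOn_exp_neg_sq {σ L β c : ℝ} (hσ : 0 < σ)
    (hβ : 2 * σ ^ 2 + 2 * L ^ 2 ≤ β) (hc : |c| ≤ L) :
    ConcaveOn ℝ (Set.Icc (-L) L) fun u : ℝ =>
      Real.exp (-u ^ 2 / β + σ ^ 2 * (2 * (u - c) / β) ^ 2 / 2) := by
  have hβ0 : 0 < β := by nlinarith [sq_nonneg L, pow_pos hσ 2]
  set q : ℝ → ℝ := fun u => -u ^ 2 / β + σ ^ 2 * (2 * (u - c) / β) ^ 2 / 2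
  set q' : ℝ → ℝ := fun u => -(2 * ((β - 2 * σ ^ 2) * u + 2 * σ ^ 2 * c)) / β ^ 2
  have hq : ∀ u, HasDerivAt q (q' u) u := by
    intro u
    have h1 : HasDerivAt (fun u : ℝ => -u ^ 2 / β) (-(2 * u) / β) u := by
      simpa using ((hasDerivAt_pow 2 u).neg).div_const β
    have h2 : HasDerivAt (fun u : ℝ => 2 * (u - c) / β) (2 / β) u := by
      simpa using (((hasDerivAt_id' u).sub_const c).const_mul 2).div_const β
    refine (h1.add (((h2.pow 2).const_mul (σ ^ 2)).div_const 2)).congr_deriv ?_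
    norm_num [q']
    field_simp
    ring
  have hq' : ∀ u, HasDerivAt q' (-(2 * (β - 2 * σ ^ 2)) / β ^ 2) u := by
    intro u
    refine ((((((hasDerivAt_id' u).const_mul (β - 2 * σ ^ 2)).add_const
      (2 * σ ^ 2 * c)).const_mul 2).neg).div_const (β ^ 2)).congr_deriv ?_
    ring
  refine concaveOn_of_hasDerivWithinAt2_nonpos (convex_Icc _ _)
    (f' := fun u => Real.exp (q u) * q' u)
    (f'' := fun u => Real.exp (q u) * (q' u ^ 2 - 2 * (β - 2 * σ ^ 2) / β ^ 2))
    (fun u _ => ((hq u).exp.continuousAt).continuousWithinAt)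
    (fun u _ => (hq u).exp.hasDerivWithinAt) (fun u _ => ?_) fun u hu => ?_
  · refine (((hq u).exp.mul (hq' u)).congr_deriv ?_).hasDerivWithinAt
    ring
  · have hu' : |u| ≤ L := abs_le.2 (Set.mem_Icc.1 (interior_subset hu))
    refine mul_nonpos_of_nonneg_of_nonpos (Real.exp_pos _).le (sub_nonpos.2 ?_)
    have ha : 0 ≤ β - 2 * σ ^ 2 := by nlinarith [sq_nonneg L]
    -- The weights β - 2σ² and 2σ² are nonnegative with sum β, and both points lie in [-L, L].
    have h1 : |(β - 2 * σ ^ 2) * u + 2 * σ ^ 2 * c| ≤ β * L := by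
      calc |(β - 2 * σ ^ 2) * u + 2 * σ ^ 2 * c|
          ≤ (β - 2 * σ ^ 2) * |u| + 2 * σ ^ 2 * |c| := by
            refine (abs_add_le _ _).trans ?_
            rw [abs_mul, abs_mul, abs_of_nonneg ha,
              abs_of_nonneg (show 0 ≤ 2 * σ ^ 2 by positivity)]
        _ ≤ (β - 2 * σ ^ 2) * L + 2 * σ ^ 2 * L := by gcongr
        _ = β * L := by ring
    have h2 : ((β - 2 * σ ^ 2) * u + 2 * σ ^ 2 * c) ^ 2 ≤ (β * L) ^ 2 := by
      rw [← sq_abs]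
      gcongr
    have h3 : q' u ^ 2 = 4 * ((β - 2 * σ ^ 2) * u + 2 * σ ^ 2 * c) ^ 2 / β ^ 4 := by
      simp only [q']
      ring
    rw [h3, div_le_div_iff₀ (by positivity) (by positivity)]
    calc 4 * ((β - 2 * σ ^ 2) * u + 2 * σ ^ 2 * c) ^ 2 * β ^ 2
        ≤ 4 * (β * L) ^ 2 * β ^ 2 := by gcongr
      _ = 2 * (2 * L ^ 2) * β ^ 4 := by ring
      _ ≤ 2 * (β - 2 * σ ^ 2) * β ^ 4 := by
        gcongr
        linarith

end Concavity

/-! ### Partition functions and exponential concavity of the squared loss. -/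

section Partition

variable {W : Type*} [MeasurableSpace W] {θ : Measure W} [IsProbabilityMeasure θ]

lemma abs_integral_le {g : W → ℝ} {C : ℝ} (h : ∀ᵐ w ∂θ, |g w| ≤ C) : |∫ w, g w ∂θ| ≤ C := by
  simpa using norm_integral_le_of_norm_le_const (μ := θ) (f := g) h

lemma integrable_exp_neg {G : W → ℝ} (hG : Measurable G) (h0 : ∀ w, 0 ≤ G w) :
    Integrable (fun w => Real.exp (-G w)) θ := by
  refine Integrable.of_bound (by fun_prop) 1 (.of_forall fun w => ?_)
  rw [Real.norm_of_nonneg (Real.exp_pos _).le, Real.exp_le_one_iff]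
  linarith [h0 w]

lemma integral_exp_neg_le_one {G : W → ℝ} (hG : Measurable G) (h0 : ∀ w, 0 ≤ G w) :
    ∫ w, Real.exp (-G w) ∂θ ≤ 1 := by
  have := integral_mono (integrable_exp_neg (θ := θ) hG h0) (integrable_const (1 : ℝ)) fun w => by
    rw [Real.exp_le_one_iff]
    linarith [h0 w]
  simpa using this

lemma exp_neg_le_integral_exp_neg {G : W → ℝ} {C : ℝ} (hG : Measurable G) (h0 : ∀ w, 0 ≤ G w)
    (hC : ∀ᵐ w ∂θ, G w ≤ C) : Real.exp (-C) ≤ ∫ w, Real.exp (-G w) ∂θ := by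
  have := integral_mono_ae (integrable_const (μ := θ) (Real.exp (-C)))
    (integrable_exp_neg (θ := θ) hG h0) (hC.mono fun w hw => by
      simp only
      gcongr)
  simpa using this

lemma integral_exp_neg_pos {G : W → ℝ} (hG : Measurable G) (h0 : ∀ w, 0 ≤ G w) :
    0 < ∫ w, Real.exp (-G w) ∂θ :=
  integral_exp_pos (integrable_exp_neg hG h0)

/-- The integral lies between exp(-C) and 1. This turns upper bounds on the loss into integrability
of log-partition functions. -/
lemma abs_log_integral_exp_neg_le {G : W → ℝ} {C : ℝ} (hG : Measurable G) (h0 : ∀ w, 0 ≤ G w)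
    (hC : ∀ᵐ w ∂θ, G w ≤ C) : |Real.log (∫ w, Real.exp (-G w) ∂θ)| ≤ C := by
  have h1 := exp_neg_le_integral_exp_neg hG h0 hC
  have h2 := Real.log_nonpos (integral_exp_neg_pos (θ := θ) hG h0).le
    (integral_exp_neg_le_one (θ := θ) hG h0)
  have h3 := (Real.le_log_iff_exp_le (integral_exp_neg_pos (θ := θ) hG h0)).2 h1
  rw [abs_of_nonpos h2]
  linarith

/-- Exponential concavity of the squared loss under a sub-Gaussian noise `y - a` with law `μ`. -/
lemma lintegral_mixture_le {σ b L β a : ℝ} (hσ : 0 < σ)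
    (hβ : 2 * σ ^ 2 + 2 * L ^ 2 ≤ β) {u : W → ℝ} (hu : Measurable u)
    (huL : ∀ᵐ w ∂θ, |u w| ≤ L) (hub : ∀ᵐ w ∂θ, |2 * (u w - ∫ v, u v ∂θ) / β| ≤ b)
    {μ : Measure ℝ} [SFinite μ]
    (hμ : ∀ t : ℝ, |t| ≤ b → ∫⁻ y, ENNReal.ofReal (Real.exp (t * (y - a))) ∂μ ≤
      ENNReal.ofReal (Real.exp (σ ^ 2 * t ^ 2 / 2))) :
    ∫⁻ y, ENNReal.ofReal (∫ w, Real.exp (-u w ^ 2 / β +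
        2 * (u w - ∫ v, u v ∂θ) / β * (y - a)) ∂θ) ∂μ ≤
      ENNReal.ofReal (Real.exp (-(∫ v, u v ∂θ) ^ 2 / β)) := by
  have hβ0 : 0 < β := by nlinarith [sq_nonneg L, pow_pos hσ 2]
  have huI : Integrable u θ := Integrable.of_bound hu.aestronglyMeasurable L huL
  set c := ∫ v, u v ∂θ
  have hc : |c| ≤ L := abs_integral_le huL
  have hint : ∀ y, Integrable (fun w => Real.exp (-u w ^ 2 / β +
      2 * (u w - c) / β * (y - a))) θ := by
    intro y
    refine Integrable.of_bound (by fun_prop) (Real.exp (b * |y - a|)) (hub.mono fun w hw => ?_)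
    rw [Real.norm_of_nonneg (Real.exp_pos _).le, Real.exp_le_exp]
    have h1 : -u w ^ 2 / β ≤ 0 := div_nonpos_of_nonpos_of_nonneg (by nlinarith) hβ0.le
    have h2 : 2 * (u w - c) / β * (y - a) ≤ |2 * (u w - c) / β| * |y - a| := by
      rw [← abs_mul]
      exact le_abs_self _
    have h3 : |2 * (u w - c) / β| * |y - a| ≤ b * |y - a| := by gcongr
    linarith
  set g : ℝ → ℝ := fun v => Real.exp (-v ^ 2 / β + σ ^ 2 * (2 * (v - c) / β) ^ 2 / 2)
  have hg : Continuous g := by fun_prop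
  have hgI : Integrable (fun w => g (u w)) θ := by
    obtain ⟨C, hC⟩ := (isCompact_Icc (a := -L) (b := L)).exists_bound_of_continuousOn hg.continuousOn
    exact Integrable.of_bound (hg.measurable.comp hu).aestronglyMeasurable C
      (huL.mono fun w hw => hC _ (abs_le.1 hw))
  calc _ = ∫⁻ y, ∫⁻ w, ENNReal.ofReal (Real.exp (-u w ^ 2 / β + 2 * (u w - c) / β * (y - a))) ∂θ ∂μ :=
        lintegral_congr fun y => ofReal_integral_eq_lintegral_ofReal (hint y)
          (.of_forall fun w => (Real.exp_pos _).le)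
    _ = ∫⁻ w, ∫⁻ y, ENNReal.ofReal (Real.exp (-u w ^ 2 / β + 2 * (u w - c) / β * (y - a))) ∂μ ∂θ := by
        refine lintegral_lintegral_swap ?_
        unfold Function.uncurry
        fun_prop
    -- For fixed `w` the exponent is affine in the noise, with slope in the range [-b, b] of the
    -- moment condition.
    _ ≤ ∫⁻ w, ENNReal.ofReal (g (u w)) ∂θ := by
        refine lintegral_mono_ae (hub.mono fun w hw => ?_)
        simp only [Real.exp_add, ENNReal.ofReal_mul (Real.exp_pos _).le, g]
        rw [lintegral_const_mul' _ _ ENNReal.ofReal_ne_top]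
        gcongr
        exact hμ _ hw
    _ = ENNReal.ofReal (∫ w, g (u w) ∂θ) :=
        (ofReal_integral_eq_lintegral_ofReal hgI (.of_forall fun w => (Real.exp_pos _).le)).symm
    -- Jensen for the concave function; at the mean `c` the variance term of `g` vanishes.
    _ ≤ ENNReal.ofReal (g c) := by
        refine ENNReal.ofReal_le_ofReal ?_
        exact (concaveOn_exp_neg_sq hσ hβ hc).le_map_integral hg.continuousOn isClosed_Icc
          (huL.mono fun w hw => abs_le.1 hw) huI hgI
    _ = _ := by simp [g]

end Partition

/-- The assumptions on the law `P` of an observation, on the dictionary and on the temperature,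
with the essential suprema replaced by almost sure bounds. -/
structure Admissible {𝒳 : Type*} [MeasurableSpace 𝒳] (P : Measure (𝒳 × ℝ)) [IsFiniteMeasure P]
    {M : ℕ} (f : 𝒳 → ℝ) (φ : Fin M → 𝒳 → ℝ) (σ b R L Lφ β : ℝ) : Prop where
  regression : IsRegressionFunction P f
  memLp : MemLp (fun z : 𝒳 × ℝ => z.2 - f z.1) 2 P
  measurable_dict : ∀ j, Measurable (φ j)
  dict_bound : ∀ᵐ x ∂P.fst, ∀ j, |φ j x| ≤ Lφ
  dev_bound : ∀ᵐ x ∂P.fst, ∀ w ∈ l1ball M R, |linComb φ w x - f x| ≤ L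
  moment : CondExpMoment P f σ b
  sigma_pos : 0 < σ
  dict_nonneg : 0 ≤ Lφ
  radius_pos : 0 < R
  temp_dev : 2 * σ ^ 2 + 2 * L ^ 2 ≤ β
  temp_dict : 4 * R * Lφ ≤ b * β

/-! ### Linear combinations of the dictionary and their loss. -/

section LinComb

variable {𝒳 : Type*} {M : ℕ} {φ : Fin M → 𝒳 → ℝ}

lemma measurable_linComb_uncurry [MeasurableSpace 𝒳] (hφ : ∀ j, Measurable (φ j)) :
    Measurable fun p : (Fin M → ℝ) × 𝒳 => linComb φ p.1 p.2 := by
  unfold linComb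
  fun_prop

lemma measurable_linComb [MeasurableSpace 𝒳] (hφ : ∀ j, Measurable (φ j)) (w : Fin M → ℝ) :
    Measurable (linComb φ w) :=
  (measurable_linComb_uncurry hφ).comp measurable_prodMk_left

lemma continuous_linComb (x : 𝒳) : Continuous fun w : Fin M → ℝ => linComb φ w x := by
  unfold linComb
  fun_prop

lemma abs_linComb_le {x : 𝒳} {B R : ℝ} (hB : ∀ j, |φ j x| ≤ B) (hB0 : 0 ≤ B) {w : Fin M → ℝ}
    (hw : w ∈ l1ball M R) : |linComb φ w x| ≤ R * B := by
  calc |linComb φ w x| ≤ ∑ j, |w j| * B := by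
        refine (Finset.abs_sum_le_sum_abs _ _).trans (Finset.sum_le_sum fun j _ => ?_)
        rw [abs_mul]
        gcongr
        exact hB j
    _ = l1norm w * B := by rw [← Finset.sum_mul, l1norm]
    _ ≤ R * B := by
        gcongr
        exact hw

lemma contrast_nonneg (z : 𝒳 × ℝ) (g : 𝒳 → ℝ) : 0 ≤ contrast z g := sq_nonneg _

lemma contrast_le {z : 𝒳 × ℝ} {f g : 𝒳 → ℝ} {L : ℝ} (hg : |g z.1 - f z.1| ≤ L) :
    contrast z g ≤ 2 * (z.2 - f z.1) ^ 2 + 2 * L ^ 2 := by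
  have h1 : (g z.1 - f z.1) ^ 2 ≤ L ^ 2 := by
    rw [← sq_abs]
    gcongr
  unfold contrast
  nlinarith [sq_nonneg (z.2 - f z.1 + (g z.1 - f z.1))]

end LinComb

/-! ### Orthogonality of the error and bias–variance decomposition. -/

section Error

variable {𝒳 : Type*} [MeasurableSpace 𝒳] {P : Measure (𝒳 × ℝ)} {f : 𝒳 → ℝ}

lemma ae_fst {p : 𝒳 → Prop} (h : ∀ᵐ x ∂P.fst, p x) : ∀ᵐ z ∂P, p z.1 :=
  ae_of_ae_map measurable_fst.aemeasurable h

variable [IsProbabilityMeasure P]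

lemma lintegral_disintegrate {F : 𝒳 × ℝ → ℝ≥0∞} (hF : Measurable F) :
    ∫⁻ z, F z ∂P = ∫⁻ x, ∫⁻ y, F (x, y) ∂(P.condKernel x) ∂P.fst := by
  rw [← Measure.lintegral_compProd hF, P.disintegrate P.condKernel]

/-- The error is orthogonal to bounded functions of the design. -/
lemma integral_error_mul_eq_zero (hf : IsRegressionFunction P f)
    (hξ : Integrable (fun z : 𝒳 × ℝ => z.2 - f z.1) P) {g : 𝒳 → ℝ} {C : ℝ} (hg : Measurable g)
    (hgC : ∀ᵐ x ∂P.fst, |g x| ≤ C) : ∫ z, (z.2 - f z.1) * g z.1 ∂P = 0 := by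
  have hI : Integrable (fun z : 𝒳 × ℝ => (z.2 - f z.1) * g z.1) P :=
    hξ.mul_bdd (hg.comp measurable_fst).aestronglyMeasurable (ae_fst hgC)
  have hP := P.disintegrate P.condKernel
  have hY := hf.2.1
  rw [← hP] at hI hY
  conv_lhs => rw [← hP]
  rw [Measure.integral_compProd hI]
  refine integral_eq_zero_of_ae ?_
  filter_upwards [hf.2.2, ((Measure.integrable_compProd_iff hY.aestronglyMeasurable).1 hY).1]
    with x hx hxI
  rw [integral_mul_const, integral_sub hxI (integrable_const _), ← hx]
  simp

/-- The bias-variance decomposition of the prediction risk. -/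
lemma integral_sq_sub (hf : IsRegressionFunction P f)
    (hξ : MemLp (fun z : 𝒳 × ℝ => z.2 - f z.1) 2 P) {g : 𝒳 → ℝ} {C : ℝ} (hg : Measurable g)
    (hgC : ∀ᵐ x ∂P.fst, |g x - f x| ≤ C) :
    Integrable (fun z : 𝒳 × ℝ => (z.2 - g z.1) ^ 2) P ∧
    ∫ z, (z.2 - g z.1) ^ 2 ∂P = ∫ x, (g x - f x) ^ 2 ∂P.fst + ∫ z, (z.2 - f z.1) ^ 2 ∂P := by
  have hξ1 : Integrable (fun z : 𝒳 × ℝ => z.2 - f z.1) P := hξ.integrable (by norm_num)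
  have hgf : Measurable fun x => g x - f x := hg.sub hf.1
  have h1 := hξ.integrable_sq
  have h2 : Integrable (fun z : 𝒳 × ℝ => (z.2 - f z.1) * (g z.1 - f z.1)) P :=
    hξ1.mul_bdd (hgf.comp measurable_fst).aestronglyMeasurable (ae_fst hgC)
  have h3 : Integrable (fun z : 𝒳 × ℝ => (g z.1 - f z.1) ^ 2) P := by
    refine Integrable.of_bound ((hgf.pow_const 2).comp measurable_fst).aestronglyMeasurable (C ^ 2)
      ((ae_fst hgC).mono fun z hz => ?_)
    rw [Real.norm_of_nonneg (sq_nonneg _), ← sq_abs]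
    gcongr
  have hexp : (fun z : 𝒳 × ℝ => (z.2 - g z.1) ^ 2) = fun z =>
      (z.2 - f z.1) ^ 2 - 2 * ((z.2 - f z.1) * (g z.1 - f z.1)) + (g z.1 - f z.1) ^ 2 := by
    ext z
    ring
  have h4 : Integrable (fun z : 𝒳 × ℝ => (z.2 - f z.1) ^ 2 -
      2 * ((z.2 - f z.1) * (g z.1 - f z.1))) P := h1.sub (h2.const_mul 2)
  rw [hexp]
  refine ⟨h4.add h3, ?_⟩
  rw [integral_add h4 h3, integral_sub h1 (h2.const_mul 2),
    integral_const_mul, integral_error_mul_eq_zero hf hξ1 hgf hgC, Measure.fst,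
    integral_map measurable_fst.aemeasurable (hgf.pow_const 2).aestronglyMeasurable]
  ring

end Error

/-! ### Risk of a posterior mean against one fresh observation. -/

section OneStep

variable {𝒳 : Type*} [MeasurableSpace 𝒳] {P : Measure (𝒳 × ℝ)} [IsProbabilityMeasure P] {M : ℕ}
  {f : 𝒳 → ℝ} {φ : Fin M → 𝒳 → ℝ} {σ b R L Lφ β : ℝ}

lemma Admissible.temp_pos (h : Admissible P f φ σ b R L Lφ β) : 0 < β := by
  nlinarith [sq_nonneg L, pow_pos h.sigma_pos 2, h.temp_dev]

lemma measurable_contrast (hφ : ∀ j, Measurable (φ j)) :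
    Measurable fun p : (𝒳 × ℝ) × (Fin M → ℝ) => contrast p.1 (linComb φ p.2) := by
  unfold contrast linComb
  fun_prop

/-- The posterior mean of the regressor, for a posterior `θ`. -/
def mixMean (φ : Fin M → 𝒳 → ℝ) (θ : Measure (Fin M → ℝ)) (x : 𝒳) : ℝ := ∫ w, linComb φ w x ∂θ

lemma measurable_mixMean (hφ : ∀ j, Measurable (φ j)) (θ : Measure (Fin M → ℝ)) [SFinite θ] :
    Measurable (mixMean φ θ) :=
  (StronglyMeasurable.integral_prod_left' (μ := θ)
    (measurable_linComb_uncurry hφ).stronglyMeasurable).measurable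

/-- The partition function of one observation. -/
def mixExp (φ : Fin M → 𝒳 → ℝ) (β : ℝ) (θ : Measure (Fin M → ℝ)) (z : 𝒳 × ℝ) : ℝ :=
  ∫ w, Real.exp (-(1 / β * contrast z (linComb φ w))) ∂θ

lemma measurable_mixExp (hφ : ∀ j, Measurable (φ j)) (θ : Measure (Fin M → ℝ)) [SFinite θ] :
    Measurable (mixExp φ β θ) := by
  have := measurable_contrast hφ
  refine (StronglyMeasurable.integral_prod_right' (ν := θ) (f := fun p : (𝒳 × ℝ) × (Fin M → ℝ) =>
    Real.exp (-(1 / β * contrast p.1 (linComb φ p.2)))) ?_).measurable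
  exact Measurable.stronglyMeasurable (by fun_prop)

variable {θ : Measure (Fin M → ℝ)} [IsProbabilityMeasure θ]

omit [MeasurableSpace 𝒳] in
lemma integrable_linComb {x : 𝒳} (hx : ∀ w ∈ l1ball M R, |linComb φ w x - f x| ≤ L)
    (hθ : ∀ᵐ w ∂θ, w ∈ l1ball M R) : Integrable (fun w => linComb φ w x) θ := by
  have h1 : Integrable (fun w => linComb φ w x - f x) θ :=
    Integrable.of_bound ((continuous_linComb x).sub continuous_const).aestronglyMeasurable L
      (hθ.mono hx)
  exact (h1.add (integrable_const (f x))).congr (.of_forall fun w => by simp)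

omit [MeasurableSpace 𝒳] in
lemma abs_mixMean_sub_le {x : 𝒳} (hx : ∀ w ∈ l1ball M R, |linComb φ w x - f x| ≤ L)
    (hθ : ∀ᵐ w ∂θ, w ∈ l1ball M R) : |mixMean φ θ x - f x| ≤ L := by
  have h := abs_integral_le (hθ.mono hx)
  rw [integral_sub (integrable_linComb hx hθ) (integrable_const _)] at h
  simpa [mixMean] using h

lemma Admissible.integrable_log_mixExp (h : Admissible P f φ σ b R L Lφ β)
    (hθ : ∀ᵐ w ∂θ, w ∈ l1ball M R) : Integrable (fun z => Real.log (mixExp φ β θ z)) P := by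
  have hβ := h.temp_pos
  have hdom : Integrable (fun z : 𝒳 × ℝ =>
      1 / β * (2 * (z.2 - f z.1) ^ 2 + 2 * L ^ 2)) P :=
    ((h.memLp.integrable_sq.const_mul 2).add (integrable_const _)).const_mul _
  refine hdom.mono' (measurable_mixExp h.measurable_dict θ).log.aestronglyMeasurable ?_
  filter_upwards [ae_fst h.dev_bound] with z hz
  have := (measurable_contrast h.measurable_dict).comp (measurable_prodMk_left (x := z))
  refine abs_log_integral_exp_neg_le (Measurable.const_mul this (1 / β)) (fun w => ?_)
    (hθ.mono fun w hw => ?_)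
  · have := contrast_nonneg z (linComb φ w)
    positivity
  · have := contrast_le (hz w hw)
    gcongr

/-- The left side is the prediction risk of the posterior mean. The auxiliary `U` is the mixture
divided by exp(-(y - mean)²/β); in this quotient the square of the noise cancels, leaving an
exponent affine in the noise, as `lintegral_mixture_le` requires. -/
lemma Admissible.one_step (h : Admissible P f φ σ b R L Lφ β) (hθ : ∀ᵐ w ∂θ, w ∈ l1ball M R) :
    ∫ x, (mixMean φ θ x - f x) ^ 2 ∂P.fst + ∫ z, (z.2 - f z.1) ^ 2 ∂P ≤
      -β * ∫ z, Real.log (mixExp φ β θ z) ∂P := by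
  have hβ := h.temp_pos
  have hf := h.regression
  have hm := measurable_mixMean h.measurable_dict θ
  set c : 𝒳 → ℝ := fun x => mixMean φ θ x - f x
  have hcm : Measurable c := hm.sub hf.1
  have hcL : ∀ᵐ x ∂P.fst, |c x| ≤ L := h.dev_bound.mono fun x hx => abs_mixMean_sub_le hx hθ
  -- the conditional mean of `U` given the design is at most one, by exponential concavity
  set U : 𝒳 × ℝ → ℝ := fun z => Real.exp (c z.1 ^ 2 / β) *
    ∫ w, Real.exp (-(linComb φ w z.1 - f z.1) ^ 2 / β +
      2 * (linComb φ w z.1 - f z.1 - c z.1) / β * (z.2 - f z.1)) ∂θ with hU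
  have hUm : Measurable U := by
    refine Measurable.mul (by fun_prop) ?_
    have h1 : Measurable fun p : (𝒳 × ℝ) × (Fin M → ℝ) => linComb φ p.2 p.1.1 :=
      (measurable_linComb_uncurry h.measurable_dict).comp
        (measurable_snd.prodMk (measurable_fst.comp measurable_fst))
    have hfm := hf.1
    refine (StronglyMeasurable.integral_prod_right' (ν := θ) (f := fun p : (𝒳 × ℝ) × (Fin M → ℝ) =>
      Real.exp (-(linComb φ p.2 p.1.1 - f p.1.1) ^ 2 / β +
        2 * (linComb φ p.2 p.1.1 - f p.1.1 - c p.1.1) / β * (p.1.2 - f p.1.1))) ?_).measurable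
    exact Measurable.stronglyMeasurable (by fun_prop)
  have hU0 : ∀ z, 0 ≤ U z := fun z =>
    mul_nonneg (Real.exp_pos _).le (integral_nonneg fun w => (Real.exp_pos _).le)
  have hUle : ∫⁻ z, ENNReal.ofReal (U z) ∂P ≤ 1 := by
    rw [lintegral_disintegrate hUm.ennreal_ofReal]
    calc _ ≤ ∫⁻ _, 1 ∂P.fst := lintegral_mono_ae ?_
      _ = 1 := by simp
    filter_upwards [h.dev_bound, h.dict_bound, h.moment] with x hx hxφ hxm
    have hint := integrable_linComb hx hθ
    have hmean : ∫ w, (linComb φ w x - f x) ∂θ = c x := by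
      rw [integral_sub hint (integrable_const _)]
      simp [c, mixMean]
    have hmix := lintegral_mixture_le (θ := θ) (b := b) (a := f x) (μ := P.condKernel x)
      h.sigma_pos h.temp_dev
      (u := fun w => linComb φ w x - f x)
      ((continuous_linComb x).measurable.sub_const _) (hθ.mono hx) ?_ hxm
    · rw [hmean] at hmix
      simp only [hU, ENNReal.ofReal_mul (Real.exp_pos _).le]
      rw [lintegral_const_mul' _ _ ENNReal.ofReal_ne_top]
      refine (mul_le_mul_right hmix _).trans ?_
      rw [← ENNReal.ofReal_mul (Real.exp_pos _).le, ← Real.exp_add]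
      simp [neg_div]
    · rw [hmean]
      filter_upwards [hθ] with w hw
      -- Both `linComb φ w x` and the posterior mean are bounded by R·Lφ, so the slope is at most
      -- 4R·Lφ/β ≤ b.
      have h1 := abs_linComb_le hxφ h.dict_nonneg hw
      have h2 : |mixMean φ θ x| ≤ R * Lφ :=
        abs_integral_le (hθ.mono fun v hv => abs_linComb_le hxφ h.dict_nonneg hv)
      have h3 : linComb φ w x - f x - c x = linComb φ w x - mixMean φ θ x := by
        simp only [c]
        ring
      rw [h3, abs_div, abs_of_pos hβ, div_le_iff₀ hβ, abs_mul, abs_two]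
      have h4 := abs_sub (linComb φ w x) (mixMean φ θ x)
      linarith [h.temp_dict]
  have hUI : Integrable U P := by
    refine ⟨hUm.aestronglyMeasurable, ?_⟩
    rw [hasFiniteIntegral_iff_ofReal (.of_forall hU0)]
    exact hUle.trans_lt ENNReal.one_lt_top
  have hUint : ∫ z, U z ∂P ≤ 1 := by
    rw [integral_eq_lintegral_of_nonneg_ae (.of_forall hU0) hUm.aestronglyMeasurable]
    exact ENNReal.toReal_le_of_le_ofReal zero_le_one (by simpa using hUle)
  obtain ⟨hsqI, hsq⟩ := integral_sq_sub hf h.memLp hm hcL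
  -- The remainder log U is replaced by U - 1, whose integral is at most 0.
  have hpt : ∀ᵐ z ∂P, Real.log (mixExp φ β θ z) ≤
      -(1 / β) * (z.2 - mixMean φ θ z.1) ^ 2 + (U z - 1) := by
    filter_upwards [ae_fst h.dev_bound] with z hz
    have hpos : 0 < mixExp φ β θ z := by
      have := (measurable_contrast h.measurable_dict).comp (measurable_prodMk_left (x := z))
      refine integral_exp_neg_pos (Measurable.const_mul this (1 / β)) (fun w => ?_)
      have := contrast_nonneg z (linComb φ w)
      positivity
    have heq : mixExp φ β θ z = Real.exp (-(1 / β) * (z.2 - mixMean φ θ z.1) ^ 2) * U z := by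
      simp only [hU, mixExp]
      rw [← integral_const_mul, ← integral_const_mul]
      refine integral_congr_ae (.of_forall fun w => ?_)
      simp only [← Real.exp_add, contrast, c]
      congr 1
      field_simp
      ring
    have hUpos : 0 < U z := by
      rw [heq] at hpos
      exact pos_of_mul_pos_right hpos (Real.exp_pos _).le
    rw [heq, Real.log_mul (Real.exp_pos _).ne' hUpos.ne', Real.log_exp]
    linarith [Real.log_le_sub_one_of_pos hUpos]
  have hUI1 : Integrable (fun z => U z - 1) P := hUI.sub (integrable_const 1)
  have hle := integral_mono_ae (h.integrable_log_mixExp hθ)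
    ((hsqI.const_mul (-(1 / β))).add hUI1) hpt
  simp only [Pi.add_apply] at hle
  rw [integral_add (hsqI.const_mul (-(1 / β))) hUI1, integral_const_mul,
    integral_sub hUI (integrable_const _), hsq] at hle
  simp only [integral_const, probReal_univ, smul_eq_mul, mul_one] at hle
  have h5 := mul_le_mul_of_nonneg_left hle hβ.le
  have h6 : β * (-(1 / β) * (∫ x, c x ^ 2 ∂P.fst + ∫ z, (z.2 - f z.1) ^ 2 ∂P)) =
      -(∫ x, c x ^ 2 ∂P.fst + ∫ z, (z.2 - f z.1) ^ 2 ∂P) := by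
    field_simp
  rw [mul_add, h6] at h5
  nlinarith

end OneStep

/-! ### Cumulative losses, partition functions and posteriors of a sample. -/

section Energy

variable {𝒳 : Type*} {M n : ℕ} {φ : Fin M → 𝒳 → ℝ} {β : ℝ}

/-- The scaled cumulative loss of the first `m` observations, so that
`expWeight = exp (-energy)`. -/
def energy (φ : Fin M → 𝒳 → ℝ) (β : ℝ) (Z : Fin n → 𝒳 × ℝ) (m : ℕ) (w : Fin M → ℝ) : ℝ :=
  1 / β * ∑ i : Fin n, if (i : ℕ) < m then contrast (Z i) (linComb φ w) else 0

lemma expWeight_eq (Z : Fin n → 𝒳 × ℝ) (m : ℕ) (w : Fin M → ℝ) :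
    expWeight φ β Z m w = Real.exp (-energy φ β Z m w) := by
  rw [expWeight, energy, neg_mul]

lemma energy_nonneg (hβ : 0 < β) (Z : Fin n → 𝒳 × ℝ) (m : ℕ) (w : Fin M → ℝ) :
    0 ≤ energy φ β Z m w := by
  refine mul_nonneg (by positivity) (Finset.sum_nonneg fun i _ => ?_)
  split_ifs
  · exact contrast_nonneg _ _
  · exact le_rfl

lemma continuous_energy (Z : Fin n → 𝒳 × ℝ) (m : ℕ) : Continuous (energy φ β Z m) := by
  unfold energy contrast
  refine continuous_const.mul (continuous_finsetSum _ fun i _ => ?_)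
  split_ifs
  · exact (continuous_const.sub (continuous_linComb _)).pow 2
  · exact continuous_const

lemma energy_le (hβ : 0 < β) {f : 𝒳 → ℝ} {L R : ℝ} {Z : Fin n → 𝒳 × ℝ} (m : ℕ) {w : Fin M → ℝ}
    (hw : w ∈ l1ball M R) (hZ : ∀ i, ∀ w ∈ l1ball M R, |linComb φ w (Z i).1 - f (Z i).1| ≤ L) :
    energy φ β Z m w ≤ 1 / β * ∑ i, (2 * ((Z i).2 - f (Z i).1) ^ 2 + 2 * L ^ 2) := by
  unfold energy
  gcongr with i
  split_ifs
  · exact contrast_le (hZ i w hw)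
  · positivity

lemma val_succAbove_lt_iff (k : Fin (n + 1)) (i : Fin n) :
    ((k.succAbove i : Fin (n + 1)) : ℕ) < k ↔ (i : ℕ) < k := by
  unfold Fin.succAbove
  split_ifs with h
  · simp
  · simp only [Fin.lt_def, Fin.val_castSucc, Fin.val_succ] at h ⊢
    omega

/-- Indices start at 0, so an observation inserted at place `k` is not among the first `k`; it
enters only at count `k + 1`. -/
lemma energy_insertNth (k : Fin (n + 1)) (z : 𝒳 × ℝ) (Z : Fin n → 𝒳 × ℝ) (w : Fin M → ℝ) :
    energy φ β (k.insertNth z Z : Fin (n + 1) → 𝒳 × ℝ) k w = energy φ β Z k w := by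
  unfold energy
  rw [Fin.sum_univ_succAbove _ k]
  simp only [Fin.insertNth_apply_same, Fin.insertNth_apply_succAbove, val_succAbove_lt_iff,
    lt_irrefl, if_false, zero_add]

lemma energy_insertNth_succ (k : Fin (n + 1)) (z : 𝒳 × ℝ) (Z : Fin n → 𝒳 × ℝ) (w : Fin M → ℝ) :
    energy φ β (k.insertNth z Z : Fin (n + 1) → 𝒳 × ℝ) (k + 1) w =
      energy φ β Z k w + 1 / β * contrast z (linComb φ w) := by
  have h : ∀ i : Fin n, ((k.succAbove i : Fin (n + 1)) : ℕ) < k + 1 ↔ (i : ℕ) < k := by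
    intro i
    rw [← val_succAbove_lt_iff k i, Nat.lt_succ_iff_lt_or_eq, or_iff_left]
    exact fun h => Fin.succAbove_ne k i (Fin.ext h)
  unfold energy
  rw [Fin.sum_univ_succAbove _ k]
  simp only [Fin.insertNth_apply_same, Fin.insertNth_apply_succAbove, h]
  simp only [lt_add_one, if_true]
  ring

/-- The partition function of the first `m` observations. -/
def partition (φ : Fin M → 𝒳 → ℝ) (β : ℝ) (π : Measure (Fin M → ℝ)) (Z : Fin n → 𝒳 × ℝ)
    (m : ℕ) : ℝ :=
  ∫ w, expWeight φ β Z m w ∂π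

variable [MeasurableSpace 𝒳]

lemma measurable_energy (hφ : ∀ j, Measurable (φ j)) (m : ℕ) :
    Measurable fun p : (Fin n → 𝒳 × ℝ) × (Fin M → ℝ) => energy φ β p.1 m p.2 := by
  unfold energy
  refine Measurable.const_mul (Finset.measurable_fun_sum _ fun i _ => ?_) _
  split_ifs
  · have hZ : Measurable fun p : (Fin n → 𝒳 × ℝ) × (Fin M → ℝ) => p.1 i :=
      (measurable_pi_apply i).comp measurable_fst
    exact (measurable_contrast hφ).comp (hZ.prodMk measurable_snd)
  · exact measurable_const

lemma measurable_expWeight (hφ : ∀ j, Measurable (φ j)) (m : ℕ) :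
    Measurable fun p : (Fin n → 𝒳 × ℝ) × (Fin M → ℝ) => expWeight φ β p.1 m p.2 := by
  simp only [expWeight_eq]
  exact (measurable_energy hφ m).neg.exp

variable {π : Measure (Fin M → ℝ)}

lemma measurable_partition [SFinite π] (hφ : ∀ j, Measurable (φ j)) (m : ℕ) :
    Measurable fun Z : Fin n → 𝒳 × ℝ => partition φ β π Z m :=
  (StronglyMeasurable.integral_prod_right' (ν := π)
    (measurable_expWeight hφ m).stronglyMeasurable).measurable

lemma measurable_posteriorDensityStep [SFinite π] (hφ : ∀ j, Measurable (φ j)) (m : ℕ) :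
    Measurable fun p : (Fin n → 𝒳 × ℝ) × (Fin M → ℝ) => posteriorDensityStep φ β π p.1 m p.2 :=
  (measurable_expWeight hφ m).div ((measurable_partition hφ m).comp measurable_fst)

lemma measurable_integral_linComb_mul [SFinite π] (hφ : ∀ j, Measurable (φ j))
    {ρ : (Fin n → 𝒳 × ℝ) × (Fin M → ℝ) → ℝ} (hρ : Measurable ρ) :
    Measurable fun p : (Fin n → 𝒳 × ℝ) × 𝒳 => ∫ w, linComb φ w p.2 * ρ (p.1, w) ∂π := by
  refine (StronglyMeasurable.integral_prod_right' (ν := π)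
    (f := fun q : ((Fin n → 𝒳 × ℝ) × 𝒳) × (Fin M → ℝ) =>
      linComb φ q.2 q.1.2 * ρ (q.1.1, q.2)) ?_).measurable
  refine ((measurable_linComb_uncurry hφ).comp (measurable_snd.prodMk ?_)).mul (hρ.comp ?_)
    |>.stronglyMeasurable
  · exact measurable_snd.comp measurable_fst
  · exact (measurable_fst.comp measurable_fst).prodMk measurable_snd

lemma measurable_maAggregate [SFinite π] (hφ : ∀ j, Measurable (φ j)) :
    Measurable fun p : (Fin n → 𝒳 × ℝ) × 𝒳 => maAggregate φ β π p.1 p.2 := by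
  unfold maAggregate
  refine measurable_integral_linComb_mul hφ (ρ := fun q => posteriorDensity φ β π q.1 q.2) ?_
  unfold posteriorDensity
  exact (Finset.measurable_fun_sum _ fun m _ => measurable_posteriorDensityStep hφ m).const_mul _

/-- The posterior after `m` observations. -/
def posterior (φ : Fin M → 𝒳 → ℝ) (β : ℝ) (π : Measure (Fin M → ℝ)) (Z : Fin n → 𝒳 × ℝ)
    (m : ℕ) : Measure (Fin M → ℝ) :=
  π.withDensity fun w => ENNReal.ofReal (posteriorDensityStep φ β π Z m w)

variable [IsProbabilityMeasure π]

omit [MeasurableSpace 𝒳] in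
lemma integrable_expWeight (hβ : 0 < β) (Z : Fin n → 𝒳 × ℝ) (m : ℕ) :
    Integrable (expWeight φ β Z m) π :=
  (integrable_exp_neg (continuous_energy Z m).measurable (energy_nonneg hβ Z m)).congr
    (.of_forall fun w => (expWeight_eq Z m w).symm)

omit [MeasurableSpace 𝒳] in
lemma partition_pos (hβ : 0 < β) (Z : Fin n → 𝒳 × ℝ) (m : ℕ) :
    0 < partition φ β π Z m := by
  unfold partition
  simp only [expWeight_eq]
  exact integral_exp_neg_pos (continuous_energy Z m).measurable (energy_nonneg hβ Z m)

omit [MeasurableSpace 𝒳] [IsProbabilityMeasure π] in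
lemma continuous_posteriorDensityStep (Z : Fin n → 𝒳 × ℝ) (m : ℕ) :
    Continuous (posteriorDensityStep φ β π Z m) := by
  unfold posteriorDensityStep
  simp only [expWeight_eq]
  exact (continuous_energy Z m).neg.rexp.div_const _

omit [MeasurableSpace 𝒳] in
lemma posteriorDensityStep_nonneg (hβ : 0 < β) (Z : Fin n → 𝒳 × ℝ)
    (m : ℕ) (w : Fin M → ℝ) : 0 ≤ posteriorDensityStep φ β π Z m w :=
  div_nonneg (Real.exp_pos _).le (partition_pos hβ Z m).le

omit [MeasurableSpace 𝒳] in
lemma isProbabilityMeasure_posterior (hβ : 0 < β)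
    (Z : Fin n → 𝒳 × ℝ) (m : ℕ) : IsProbabilityMeasure (posterior φ β π Z m) := by
  constructor
  rw [posterior, withDensity_apply _ MeasurableSet.univ, Measure.restrict_univ,
    ← ofReal_integral_eq_lintegral_ofReal (f := posteriorDensityStep φ β π Z m)
      ((integrable_expWeight hβ Z m).div_const _)
      (.of_forall (posteriorDensityStep_nonneg hβ Z m))]
  have := (partition_pos (φ := φ) (π := π) hβ Z m).ne'
  unfold posteriorDensityStep
  rw [integral_div]
  change ENNReal.ofReal (partition φ β π Z m / partition φ β π Z m) = 1
  rw [div_self this, ENNReal.ofReal_one]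

omit [MeasurableSpace 𝒳] [IsProbabilityMeasure π] in
lemma ae_posterior {p : (Fin M → ℝ) → Prop} (h : ∀ᵐ w ∂π, p w) (Z : Fin n → 𝒳 × ℝ) (m : ℕ) :
    ∀ᵐ w ∂(posterior φ β π Z m), p w :=
  (withDensity_absolutelyContinuous _ _).ae_le h

omit [MeasurableSpace 𝒳] in
lemma integral_posterior (hβ : 0 < β) (Z : Fin n → 𝒳 × ℝ) (m : ℕ)
    (g : (Fin M → ℝ) → ℝ) : ∫ w, g w ∂(posterior φ β π Z m) =
      ∫ w, g w * posteriorDensityStep φ β π Z m w ∂π := by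
  rw [posterior, integral_withDensity_eq_integral_toReal_smul
    (continuous_posteriorDensityStep Z m).measurable.ennreal_ofReal
    (.of_forall fun _ => ENNReal.ofReal_lt_top)]
  refine integral_congr_ae (.of_forall fun w => ?_)
  simp only [smul_eq_mul]
  rw [ENNReal.toReal_ofReal (posteriorDensityStep_nonneg hβ Z m w), mul_comm]

omit [MeasurableSpace 𝒳] [IsProbabilityMeasure π] in
lemma partition_insertNth (k : Fin (n + 1)) (z : 𝒳 × ℝ) (Z : Fin n → 𝒳 × ℝ) :
    partition φ β π (k.insertNth z Z : Fin (n + 1) → 𝒳 × ℝ) k = partition φ β π Z k := by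
  simp only [partition, expWeight_eq, energy_insertNth]

-- The normalization of the posterior contributes the denominator, and the inserted observation
-- extends the exponential weight; this is what makes the one-step bounds telescope.
omit [MeasurableSpace 𝒳] in
lemma log_mixExp_posterior (hβ : 0 < β) (k : Fin (n + 1))
    (z : 𝒳 × ℝ) (Z : Fin n → 𝒳 × ℝ) :
    Real.log (mixExp φ β (posterior φ β π Z k) z) =
      Real.log (partition φ β π (k.insertNth z Z : Fin (n + 1) → 𝒳 × ℝ) (k + 1)) -
        Real.log (partition φ β π Z k) := by
  rw [← Real.log_div (partition_pos hβ _ _).ne' (partition_pos hβ _ _).ne', mixExp,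
    integral_posterior hβ]
  congr 1
  rw [partition, ← integral_div]
  refine integral_congr_ae (.of_forall fun w => ?_)
  simp only [expWeight_eq, energy_insertNth_succ, posteriorDensityStep, neg_add, Real.exp_add,
    partition]
  ring

end Energy

/-! ### Telescoping the one-step bounds along the sample. -/

section Telescope

variable {𝒳 : Type*} [MeasurableSpace 𝒳] {P : Measure (𝒳 × ℝ)} [IsProbabilityMeasure P]
  {M n : ℕ} {f : 𝒳 → ℝ} {φ : Fin M → 𝒳 → ℝ} {σ b R L Lφ β : ℝ}

/-- The law of a sample of size `n`. -/
abbrev sampleLaw (P : Measure (𝒳 × ℝ)) (n : ℕ) : Measure (Fin n → 𝒳 × ℝ) :=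
  Measure.pi fun _ => P

lemma measurePreserving_insertNth (k : Fin (n + 1)) :
    MeasurePreserving (fun p : (𝒳 × ℝ) × (Fin n → 𝒳 × ℝ) =>
      (k.insertNth p.1 p.2 : Fin (n + 1) → 𝒳 × ℝ)) (P.prod (sampleLaw P n))
      (sampleLaw P (n + 1)) :=
  (measurePreserving_piFinSuccAbove (fun _ : Fin (n + 1) => P) k).symm

lemma integrable_insertNth (k : Fin (n + 1)) {F : (Fin (n + 1) → 𝒳 × ℝ) → ℝ}
    (hF : Integrable F (sampleLaw P (n + 1))) :
    Integrable (fun p : (𝒳 × ℝ) × (Fin n → 𝒳 × ℝ) => F (k.insertNth p.1 p.2))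
      (P.prod (sampleLaw P n)) :=
  (measurePreserving_insertNth k).integrable_comp_of_integrable hF

lemma integral_insertNth (k : Fin (n + 1)) {F : (Fin (n + 1) → 𝒳 × ℝ) → ℝ}
    (hF : Integrable F (sampleLaw P (n + 1))) :
    ∫ Z, F Z ∂(sampleLaw P (n + 1)) =
      ∫ Z, ∫ z, F (k.insertNth z Z) ∂P ∂(sampleLaw P n) := by
  rw [← integral_prod_symm _ (integrable_insertNth k hF)]
  exact ((measurePreserving_piFinSuccAbove (fun _ : Fin (n + 1) => P) k).symm.integral_comp'
    (g := F)).symm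

lemma ae_sampleLaw {p : 𝒳 × ℝ → Prop} (h : ∀ᵐ z ∂P, p z) :
    ∀ᵐ Z ∂(sampleLaw P n), ∀ i, p (Z i) :=
  ae_all_iff.2 fun i => (measurePreserving_eval (fun _ : Fin n => P) i).quasiMeasurePreserving.ae h

lemma integrable_eval (i : Fin n) {g : 𝒳 × ℝ → ℝ} (hg : Integrable g P) :
    Integrable (fun Z : Fin n → 𝒳 × ℝ => g (Z i)) (sampleLaw P n) :=
  (measurePreserving_eval (fun _ : Fin n => P) i).integrable_comp_of_integrable hg

lemma integral_eval (i : Fin n) {g : 𝒳 × ℝ → ℝ} (hg : Integrable g P) :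
    ∫ Z : Fin n → 𝒳 × ℝ, g (Z i) ∂(sampleLaw P n) = ∫ z, g z ∂P := by
  have h := measurePreserving_eval (fun _ : Fin n => P) i
  have hm := integral_map (φ := Function.eval i) h.measurable.aemeasurable
    (f := g) (by rw [h.map_eq]; exact hg.aestronglyMeasurable)
  rw [h.map_eq] at hm
  exact hm.symm

variable {π : Measure (Fin M → ℝ)} [IsProbabilityMeasure π]

lemma Admissible.integrable_log_partition (h : Admissible P f φ σ b R L Lφ β)
    (hπ : ∀ᵐ w ∂π, w ∈ l1ball M R) (m : ℕ) :
    Integrable (fun Z : Fin n → 𝒳 × ℝ => Real.log (partition φ β π Z m)) (sampleLaw P n) := by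
  have hβ := h.temp_pos
  have hdom : Integrable (fun Z : Fin n → 𝒳 × ℝ =>
      1 / β * ∑ i, (2 * ((Z i).2 - f (Z i).1) ^ 2 + 2 * L ^ 2)) (sampleLaw P n) :=
    (integrable_finsetSum _ fun i _ => integrable_eval i
      ((h.memLp.integrable_sq.const_mul 2).add (integrable_const _))).const_mul _
  refine hdom.mono' (measurable_partition h.measurable_dict m).log.aestronglyMeasurable ?_
  filter_upwards [ae_sampleLaw (ae_fst h.dev_bound)] with Z hZ
  simp only [partition, expWeight_eq]
  exact abs_log_integral_exp_neg_le (continuous_energy Z m).measurable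
    (energy_nonneg hβ Z m) (hπ.mono fun w hw => energy_le hβ m hw hZ)

/-- The squared loss of the posterior mean after `m` observations. -/
def posteriorLoss (P : Measure (𝒳 × ℝ)) (f : 𝒳 → ℝ) (φ : Fin M → 𝒳 → ℝ) (β : ℝ)
    (π : Measure (Fin M → ℝ)) (m : ℕ) (Z : Fin n → 𝒳 × ℝ) : ℝ :=
  ∫ x, (mixMean φ (posterior φ β π Z m) x - f x) ^ 2 ∂P.fst

lemma measurable_mixMean_posterior (hφ : ∀ j, Measurable (φ j)) (hβ : 0 < β) (m : ℕ) :
    Measurable fun p : (Fin n → 𝒳 × ℝ) × 𝒳 => mixMean φ (posterior φ β π p.1 m) p.2 := by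
  simp only [mixMean, integral_posterior hβ]
  exact measurable_integral_linComb_mul hφ (measurable_posteriorDensityStep hφ m)

lemma Admissible.ae_abs_mixMean_sub_le (h : Admissible P f φ σ b R L Lφ β)
    (hπ : ∀ᵐ w ∂π, w ∈ l1ball M R) (m : ℕ) (Z : Fin n → 𝒳 × ℝ) :
    ∀ᵐ x ∂P.fst, |mixMean φ (posterior φ β π Z m) x - f x| ≤ L := by
  have := isProbabilityMeasure_posterior (φ := φ) (π := π) h.temp_pos Z m
  exact h.dev_bound.mono fun x hx => abs_mixMean_sub_le hx (ae_posterior hπ Z m)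

lemma Admissible.integrable_posteriorLoss (h : Admissible P f φ σ b R L Lφ β)
    (hπ : ∀ᵐ w ∂π, w ∈ l1ball M R) (m : ℕ) :
    Integrable (posteriorLoss (n := n) P f φ β π m) (sampleLaw P n) := by
  have hfm := h.regression.1
  have hm := measurable_mixMean_posterior (n := n) (π := π) h.measurable_dict h.temp_pos m
  refine Integrable.of_bound (C := L ^ 2) (Measurable.aestronglyMeasurable ?_)
    (.of_forall fun Z => ?_)
  · exact (StronglyMeasurable.integral_prod_right' (ν := P.fst)
      (f := fun p : (Fin n → 𝒳 × ℝ) × 𝒳 => (mixMean φ (posterior φ β π p.1 m) p.2 - f p.2) ^ 2)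
      ((hm.sub (hfm.comp measurable_snd)).pow_const 2).stronglyMeasurable).measurable
  · refine abs_integral_le ((h.ae_abs_mixMean_sub_le hπ m Z).mono fun x hx => ?_)
    rw [abs_of_nonneg (sq_nonneg _), ← sq_abs]
    gcongr

/-- Fubini isolates coordinate `k` of a sample of size n + 1: the other n coordinates determine the
posterior after `k` observations, and coordinate `k` is the fresh observation of
`Admissible.one_step`. -/
lemma Admissible.posteriorLoss_step (h : Admissible P f φ σ b R L Lφ β)
    (hπ : ∀ᵐ w ∂π, w ∈ l1ball M R) (k : Fin (n + 1)) :
    ∫ Z, posteriorLoss P f φ β π k Z ∂(sampleLaw P n) + ∫ z, (z.2 - f z.1) ^ 2 ∂P ≤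
      β * ∫ Z, Real.log (partition φ β π Z k) ∂(sampleLaw P (n + 1)) -
      β * ∫ Z, Real.log (partition φ β π Z (k + 1)) ∂(sampleLaw P (n + 1)) := by
  have hβ := h.temp_pos
  have hI0 := h.integrable_log_partition (n := n + 1) hπ k
  have hI1 := h.integrable_log_partition (n := n + 1) hπ (k + 1)
  have hI0' := h.integrable_log_partition (n := n) hπ k
  have hJ1 := (integrable_insertNth k hI1).integral_prod_right
  have hloss := h.integrable_posteriorLoss (n := n) hπ k
  rw [integral_insertNth k hI0, integral_insertNth k hI1]
  simp only [partition_insertNth, integral_const, probReal_univ, one_smul]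
  have hpt : ∀ᵐ Z ∂(sampleLaw P n), posteriorLoss P f φ β π k Z + ∫ z, (z.2 - f z.1) ^ 2 ∂P ≤
      β * Real.log (partition φ β π Z k) -
      β * ∫ z, Real.log (partition φ β π (k.insertNth z Z : Fin (n + 1) → 𝒳 × ℝ) (k + 1)) ∂P := by
    filter_upwards [(integrable_insertNth k hI1).prod_left_ae] with Z hZ
    have := isProbabilityMeasure_posterior (φ := φ) (π := π) hβ Z k
    refine (h.one_step (ae_posterior hπ Z k)).trans_eq ?_
    simp only [log_mixExp_posterior hβ]
    rw [integral_sub hZ (integrable_const _)]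
    simp only [integral_const, probReal_univ, one_smul]
    ring
  have hle := integral_mono_ae (hloss.add (integrable_const _))
    ((hI0'.const_mul β).sub (hJ1.const_mul β)) hpt
  simp only [Pi.add_apply, Pi.sub_apply] at hle
  rw [integral_add hloss (integrable_const _), integral_sub (hI0'.const_mul β) (hJ1.const_mul β),
    integral_const_mul, integral_const_mul] at hle
  simpa using hle

lemma Admissible.sum_posteriorLoss_le (h : Admissible P f φ σ b R L Lφ β)
    (hπ : ∀ᵐ w ∂π, w ∈ l1ball M R) :
    ∑ m ∈ Finset.range (n + 1), ∫ Z, posteriorLoss P f φ β π m Z ∂(sampleLaw P n) +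
        (n + 1) * ∫ z, (z.2 - f z.1) ^ 2 ∂P ≤
      -β * ∫ Z, Real.log (partition φ β π Z (n + 1)) ∂(sampleLaw P (n + 1)) := by
  set B : ℕ → ℝ := fun m => β * ∫ Z, Real.log (partition φ β π Z m) ∂(sampleLaw P (n + 1)) with hB
  have hstep : ∀ m ∈ Finset.range (n + 1), ∫ Z, posteriorLoss P f φ β π m Z ∂(sampleLaw P n) +
      ∫ z, (z.2 - f z.1) ^ 2 ∂P ≤ B m - B (m + 1) := fun m hm =>
    h.posteriorLoss_step (n := n) hπ ⟨m, Finset.mem_range.1 hm⟩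
  have hsum := Finset.sum_le_sum hstep
  simp only [Finset.sum_add_distrib, Finset.sum_const, Finset.card_range, nsmul_eq_mul] at hsum
  rw [Finset.sum_range_sub' B] at hsum
  -- The sum starts from the prior, whose total mass is 1, so only the last log-partition function
  -- survives.
  have h0 : ∀ Z : Fin (n + 1) → 𝒳 × ℝ, partition φ β π Z 0 = 1 := by
    intro Z
    simp [partition, expWeight]
  simp only [hB, h0, Real.log_one, integral_zero, mul_zero, zero_sub] at hsum
  push_cast at hsum
  linarith

end Telescope

/-! ### Upper bound on the free energy, and the oracle inequality. -/

section Oracle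

variable {𝒳 : Type*} [MeasurableSpace 𝒳] {P : Measure (𝒳 × ℝ)} [IsProbabilityMeasure P]
  {M n : ℕ} {f : 𝒳 → ℝ} {φ : Fin M → 𝒳 → ℝ} {σ b R L Lφ β τ : ℝ}

omit [MeasurableSpace 𝒳] in
lemma linComb_add (w v : Fin M → ℝ) (x : 𝒳) :
    linComb φ (w + v) x = linComb φ w x + linComb φ v x := by
  simp [linComb, add_mul, Finset.sum_add_distrib]

-- The symmetric prior centred at `v` has mean `v` and uncorrelated coordinates, so the averaged
-- loss is the loss at `v` plus a variance.
omit [MeasurableSpace 𝒳] in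
lemma integral_contrast_translate (hτ : 0 < τ) (hR : 0 < R) (v : Fin M → ℝ) (z : 𝒳 × ℝ) :
    ∫ w, contrast z (linComb φ (w + v)) ∂(sparsityPrior M τ R) =
      contrast z (linComb φ v) +
        ∑ j, φ j z.1 ^ 2 * ∫ w, w j ^ 2 ∂(sparsityPrior M τ R) := by
  have h := integral_add_linear_sq hτ hR (z.2 - linComb φ v z.1) fun j => -φ j z.1
  simp only [neg_sq] at h
  rw [contrast, ← h]
  refine integral_congr_ae (.of_forall fun w => ?_)
  simp only [contrast, linComb_add, mul_neg, Finset.sum_neg_distrib]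
  simp only [linComb]
  ring

omit [MeasurableSpace 𝒳] in
lemma integral_energy_translate (hτ : 0 < τ) (hR : 0 < R) (v : Fin M → ℝ)
    (Z : Fin n → 𝒳 × ℝ) :
    ∫ w, energy φ β Z n (w + v) ∂(sparsityPrior M τ R) =
      1 / β * ∑ i, (contrast (Z i) (linComb φ v) +
        ∑ j, φ j (Z i).1 ^ 2 * ∫ w, w j ^ 2 ∂(sparsityPrior M τ R)) := by
  simp only [energy, Fin.is_lt, if_true, ← integral_contrast_translate hτ hR]
  rw [integral_const_mul, integral_finsetSum]
  intro i _
  refine integrable_sparsityPrior_of_continuous hτ hR ?_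
  have := continuous_linComb (φ := φ) (Z i).1
  unfold contrast
  fun_prop

/-- An upper bound for the expected free energy of the prior. -/
lemma Admissible.neg_integral_log_partition_le (h : Admissible P f φ σ b R L Lφ β) (hτ : 0 < τ)
    (hM : 0 < M) (hφ : ∀ j, Integrable (fun x => φ j x ^ 2) P.fst)
    (hφ1 : ∀ j, ∫ x, φ j x ^ 2 ∂P.fst = 1) {v : Fin M → ℝ} (hv : l1norm v ≤ R - 2 * M * τ) :
    -β * ∫ Z, Real.log (partition φ β (sparsityPrior M τ R) Z n) ∂(sampleLaw P n) ≤
      β * transCost τ v + n * (∫ x, (linComb φ v x - f x) ^ 2 ∂P.fst +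
        ∫ z, (z.2 - f z.1) ^ 2 ∂P + 2 * τ ^ 2 * M) := by
  have hM' : (0 : ℝ) < M := by exact_mod_cast hM
  have hr : 0 < 2 * M * τ := by positivity
  have hR := h.radius_pos
  have hβ := h.temp_pos
  have := isProbabilityMeasure_sparsityPrior (M := M) hτ hR
  have hvR : v ∈ l1ball M R := hv.trans (by linarith)
  obtain ⟨hcI, hc⟩ := integral_sq_sub h.regression h.memLp (measurable_linComb h.measurable_dict v)
    (h.dev_bound.mono fun x hx => hx v hvR)
  set V : Fin M → ℝ := fun j => ∫ w, w j ^ 2 ∂(sparsityPrior M τ (2 * M * τ))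
  set g : 𝒳 × ℝ → ℝ := fun z => contrast z (linComb φ v) + ∑ j, φ j z.1 ^ 2 * V j with hg
  have hφI : ∀ j, Integrable (fun z : 𝒳 × ℝ => φ j z.1 ^ 2) P := fun j =>
    (integrable_map_measure (hφ j).aestronglyMeasurable measurable_fst.aemeasurable).1 (hφ j)
  have hφint : ∀ j, ∫ z : 𝒳 × ℝ, φ j z.1 ^ 2 ∂P = 1 := fun j => by
    rw [← hφ1 j, Measure.fst, integral_map measurable_fst.aemeasurable]
    exact (hφ j).aestronglyMeasurable
  have hsI : Integrable (fun z : 𝒳 × ℝ => ∑ j, φ j z.1 ^ 2 * V j) P :=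
    integrable_finsetSum _ fun j _ => (hφI j).mul_const _
  have hgI : Integrable g P := Integrable.add hcI hsI
  have hgle : ∫ z, g z ∂P ≤ ∫ x, (linComb φ v x - f x) ^ 2 ∂P.fst +
      ∫ z, (z.2 - f z.1) ^ 2 ∂P + 2 * τ ^ 2 * M := by
    have h1 : ∫ z, g z ∂P = ∫ z, contrast z (linComb φ v) ∂P + ∑ j, V j := by
      rw [hg, integral_add (f := fun z => contrast z (linComb φ v)) hcI hsI, integral_finsetSum _ fun j _ => (hφI j).mul_const _]
      simp only [integral_mul_const, hφint, one_mul]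
    -- The dictionary is normalized in L², so each coordinate contributes just its variance.
    have h2 : ∑ j, V j ≤ ∑ _j : Fin M, 2 * τ ^ 2 :=
      Finset.sum_le_sum fun j _ => integral_coord_sq_le hτ hM j
    rw [Finset.sum_const, Finset.card_univ, Fintype.card_fin, nsmul_eq_mul] at h2
    rw [h1]
    simp only [contrast]
    rw [hc]
    linarith
  have hpt : ∀ Z : Fin n → 𝒳 × ℝ, -transCost τ v - 1 / β * ∑ i, g (Z i) ≤
      Real.log (partition φ β (sparsityPrior M τ R) Z n) := by
    intro Z
    have := log_integral_exp_ge hτ hM hR hv (continuous_energy (φ := φ) (β := β) Z n)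
    rw [integral_energy_translate hτ hr] at this
    simpa only [partition, expWeight_eq] using! this
  have hgsum : Integrable (fun Z : Fin n → 𝒳 × ℝ => 1 / β * ∑ i, g (Z i)) (sampleLaw P n) :=
    (integrable_finsetSum _ fun i _ => integrable_eval i hgI).const_mul _
  have hle := integral_mono ((integrable_const (-transCost τ v)).sub hgsum)
    (h.integrable_log_partition (n := n) ae_mem_l1ball n) hpt
  simp only [Pi.sub_apply] at hle
  rw [integral_sub (integrable_const _) hgsum, integral_const_mul,
    integral_finsetSum _ fun i _ => integrable_eval i hgI] at hle
  simp only [integral_eval _ hgI, integral_const, probReal_univ, one_smul, Finset.sum_const,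
    Finset.card_univ, Fintype.card_fin, nsmul_eq_mul] at hle
  have h3 := mul_le_mul_of_nonneg_left hle hβ.le
  have h4 : β * (-transCost τ v - 1 / β * (n * ∫ z, g z ∂P)) =
      -(β * transCost τ v) - n * ∫ z, g z ∂P := by
    field_simp
  rw [h4] at h3
  have h5 : (n : ℝ) * ∫ z, g z ∂P ≤ n * (∫ x, (linComb φ v x - f x) ^ 2 ∂P.fst +
      ∫ z, (z.2 - f z.1) ^ 2 ∂P + 2 * τ ^ 2 * M) := by gcongr
  linarith

omit [MeasurableSpace 𝒳] in
/-- The aggregate is the average of the successive posterior means. -/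
lemma maAggregate_eq (hτ : 0 < τ) (hR : 0 < R) (hβ : 0 < β) (Z : Fin n → 𝒳 × ℝ) (x : 𝒳) :
    maAggregate φ β (sparsityPrior M τ R) Z x = 1 / ((n : ℝ) + 1) *
      ∑ m ∈ Finset.range (n + 1),
        mixMean φ (posterior φ β (sparsityPrior M τ R) Z m) x := by
  have := isProbabilityMeasure_sparsityPrior (M := M) hτ hR
  simp only [maAggregate, posteriorDensity, mixMean, integral_posterior hβ]
  rw [← integral_finsetSum, ← integral_const_mul]
  · refine integral_congr_ae (.of_forall fun w => ?_)
    simp only [Finset.mul_sum]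
    exact Finset.sum_congr rfl fun m _ => by ring
  · intro m _
    exact integrable_sparsityPrior_of_continuous hτ hR
      ((continuous_linComb x).mul (continuous_posteriorDensityStep Z m))

/-- Convexity of the square, in the form of Cauchy–Schwarz over the n + 1 posterior means. -/
lemma Admissible.integral_maAggregate_le (h : Admissible P f φ σ b R L Lφ β) (hτ : 0 < τ)
    (Z : Fin n → 𝒳 × ℝ) :
    ∫ x, (maAggregate φ β (sparsityPrior M τ R) Z x - f x) ^ 2 ∂P.fst ≤
      1 / ((n : ℝ) + 1) * ∑ m ∈ Finset.range (n + 1),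
        posteriorLoss P f φ β (sparsityPrior M τ R) m Z := by
  have hβ := h.temp_pos
  have hR := h.radius_pos
  have hfm := h.regression.1
  have := isProbabilityMeasure_sparsityPrior (M := M) hτ hR
  set μ : ℕ → 𝒳 → ℝ := fun m x => mixMean φ (posterior φ β (sparsityPrior M τ R) Z m) x - f x
  have hint : ∀ m, Integrable (fun x => μ m x ^ 2) P.fst := by
    intro m
    have := isProbabilityMeasure_posterior (φ := φ) (π := sparsityPrior M τ R) hβ Z m
    refine Integrable.of_bound (C := L ^ 2) (((measurable_mixMean h.measurable_dict _).sub
      hfm).pow_const 2).aestronglyMeasurable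
      ((h.ae_abs_mixMean_sub_le (ae_mem_l1ball (τ := τ)) m Z).mono fun x hx => ?_)
    rw [Real.norm_of_nonneg (sq_nonneg _), ← sq_abs]
    gcongr
  have hpt : ∀ x, (maAggregate φ β (sparsityPrior M τ R) Z x - f x) ^ 2 ≤
      1 / ((n : ℝ) + 1) * ∑ m ∈ Finset.range (n + 1), μ m x ^ 2 := by
    intro x
    have hn : (n : ℝ) + 1 ≠ 0 := by positivity
    have h1 : maAggregate φ β (sparsityPrior M τ R) Z x - f x =
        1 / ((n : ℝ) + 1) * ∑ m ∈ Finset.range (n + 1), μ m x := by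
      rw [maAggregate_eq hτ hR hβ]
      simp only [μ, Finset.sum_sub_distrib, Finset.sum_const, Finset.card_range, nsmul_eq_mul]
      push_cast
      field_simp
    have h2 := sq_sum_le_card_mul_sum_sq (s := Finset.range (n + 1)) (f := fun m => μ m x)
    rw [Finset.card_range] at h2
    push_cast at h2
    rw [h1, mul_pow]
    calc (1 / ((n : ℝ) + 1)) ^ 2 * (∑ m ∈ Finset.range (n + 1), μ m x) ^ 2
        ≤ (1 / ((n : ℝ) + 1)) ^ 2 * (((n : ℝ) + 1) * ∑ m ∈ Finset.range (n + 1), μ m x ^ 2) := by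
          gcongr
      _ = _ := by field_simp
  have hsum : Integrable (fun x => 1 / ((n : ℝ) + 1) * ∑ m ∈ Finset.range (n + 1), μ m x ^ 2)
      P.fst := (integrable_finsetSum _ fun m _ => hint m).const_mul _
  refine (integral_mono_of_nonneg (.of_forall fun x => sq_nonneg _) hsum
    (.of_forall hpt)).trans_eq ?_
  rw [integral_const_mul, integral_finsetSum _ fun m _ => hint m]
  rfl

lemma sqLoss_eq_lintegral {ν : Measure 𝒳} (g f : 𝒳 → ℝ) :
    sqLoss ν g f = ∫⁻ x, ENNReal.ofReal ((g x - f x) ^ 2) ∂ν := by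
  have h := eLpNorm_nnreal_pow_eq_lintegral (μ := ν) (f := fun x => g x - f x) (p := 2)
    two_ne_zero
  rw [sqLoss]
  simp only [NNReal.coe_ofNat, ENNReal.coe_ofNat, ENNReal.rpow_ofNat] at h
  rw [h]
  refine lintegral_congr fun x => ?_
  rw [Real.enorm_eq_ofReal_abs, ← ENNReal.ofReal_pow (abs_nonneg _), sq_abs]

lemma sqLoss_eq_ofReal_integral {ν : Measure 𝒳} [IsFiniteMeasure ν] {g f : 𝒳 → ℝ} {C : ℝ}
    (hg : Measurable g) (hf : Measurable f) (hC : ∀ᵐ x ∂ν, |g x - f x| ≤ C) :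
    sqLoss ν g f = ENNReal.ofReal (∫ x, (g x - f x) ^ 2 ∂ν) := by
  rw [sqLoss_eq_lintegral, ofReal_integral_eq_lintegral_ofReal _ (.of_forall fun x => sq_nonneg _)]
  refine Integrable.of_bound (C := C ^ 2) (by fun_prop) (hC.mono fun x hx => ?_)
  rw [Real.norm_of_nonneg (sq_nonneg _), ← sq_abs]
  gcongr

lemma Admissible.ae_abs_maAggregate_sub_le (h : Admissible P f φ σ b R L Lφ β) (hτ : 0 < τ)
    (Z : Fin n → 𝒳 × ℝ) :
    ∀ᵐ x ∂P.fst, |maAggregate φ β (sparsityPrior M τ R) Z x - f x| ≤ L := by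
  have := isProbabilityMeasure_sparsityPrior (M := M) hτ h.radius_pos
  have hall := ae_all_iff.2 fun m => h.ae_abs_mixMean_sub_le (ae_mem_l1ball (τ := τ)) m Z
  filter_upwards [hall] with x hx
  have hn : (0 : ℝ) < (n : ℝ) + 1 := by positivity
  have h1 : maAggregate φ β (sparsityPrior M τ R) Z x - f x =
      (∑ m ∈ Finset.range (n + 1),
        (mixMean φ (posterior φ β (sparsityPrior M τ R) Z m) x - f x)) / ((n : ℝ) + 1) := by
    rw [maAggregate_eq hτ h.radius_pos h.temp_pos]
    simp only [Finset.sum_sub_distrib, Finset.sum_const, Finset.card_range, nsmul_eq_mul]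
    push_cast
    field_simp
  rw [h1, abs_div, abs_of_pos hn, div_le_iff₀ hn]
  refine (Finset.abs_sum_le_sum_abs _ _).trans ((Finset.sum_le_sum fun m _ => hx m).trans_eq ?_)
  simp
  ring

/-- The oracle inequality at a fixed comparison vector. -/
lemma Admissible.oracle_inequality (h : Admissible P f φ σ b R L Lφ β) (hτ : 0 < τ)
    (hM : 0 < M) (hφ : ∀ j, Integrable (fun x => φ j x ^ 2) P.fst)
    (hφ1 : ∀ j, ∫ x, φ j x ^ 2 ∂P.fst = 1) {v : Fin M → ℝ} (hv : l1norm v ≤ R - 2 * M * τ) :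
    ∫⁻ Z, sqLoss P.fst (maAggregate φ β (sparsityPrior M τ R) Z) f ∂(sampleLaw P n) ≤
      sqLoss P.fst (linComb φ v) f +
        ENNReal.ofReal (4 * β / (n + 1) * ∑ j, Real.log (1 + τ⁻¹ * |v j|)) +
        ENNReal.ofReal (4 * τ ^ 2 * M + β / (n + 1)) := by
  have hM' : (0 : ℝ) < M := by exact_mod_cast hM
  have hβ := h.temp_pos
  have hR := h.radius_pos
  have hfm := h.regression.1
  have hn : (0 : ℝ) < (n : ℝ) + 1 := by positivity
  have := isProbabilityMeasure_sparsityPrior (M := M) hτ hR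
  have hvR : v ∈ l1ball M R := hv.trans (by nlinarith)
  have hlogs : 0 ≤ ∑ j, Real.log (1 + τ⁻¹ * |v j|) := Finset.sum_nonneg fun j _ =>
    Real.log_nonneg (by linarith [show 0 ≤ τ⁻¹ * |v j| by positivity])
  have hma := measurable_maAggregate (n := n) (β := β) (π := sparsityPrior M τ R) h.measurable_dict
  rw [sqLoss_eq_ofReal_integral (measurable_linComb h.measurable_dict v) hfm
    (h.dev_bound.mono fun x hx => hx v hvR), ← ENNReal.ofReal_add
    (integral_nonneg fun x => sq_nonneg _) (by positivity), ← ENNReal.ofReal_add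
    (add_nonneg (integral_nonneg fun x => sq_nonneg _) (by positivity)) (by positivity)]
  have hZ : ∀ Z : Fin n → 𝒳 × ℝ, sqLoss P.fst (maAggregate φ β (sparsityPrior M τ R) Z) f ≤
      ENNReal.ofReal (1 / ((n : ℝ) + 1) * ∑ m ∈ Finset.range (n + 1),
        posteriorLoss P f φ β (sparsityPrior M τ R) m Z) := by
    intro Z
    rw [sqLoss_eq_ofReal_integral (g := maAggregate φ β (sparsityPrior M τ R) Z)
      (hma.comp measurable_prodMk_left) hfm
      (h.ae_abs_maAggregate_sub_le hτ Z)]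
    exact ENNReal.ofReal_le_ofReal (h.integral_maAggregate_le hτ Z)
  have hloss : ∀ m, Integrable (posteriorLoss (n := n) P f φ β (sparsityPrior M τ R) m)
      (sampleLaw P n) := fun m => h.integrable_posteriorLoss ae_mem_l1ball m
  have hsum : Integrable (fun Z : Fin n → 𝒳 × ℝ => 1 / ((n : ℝ) + 1) *
      ∑ m ∈ Finset.range (n + 1), posteriorLoss P f φ β (sparsityPrior M τ R) m Z)
      (sampleLaw P n) := (integrable_finsetSum _ fun m _ => hloss m).const_mul _
  refine (lintegral_mono hZ).trans ?_
  rw [← ofReal_integral_eq_lintegral_ofReal hsum (.of_forall fun Z => mul_nonneg (by positivity)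
    (Finset.sum_nonneg fun m _ => integral_nonneg fun x => sq_nonneg _))]
  refine ENNReal.ofReal_le_ofReal ?_
  rw [integral_const_mul, integral_finsetSum _ fun m _ => hloss m]
  -- Both bounds concern the sample enlarged by the ghost observation; (n + 1) times the noise
  -- variance stands on both sides and cancels.
  have h1 := h.sum_posteriorLoss_le (n := n) (π := sparsityPrior M τ R) ae_mem_l1ball
  have h2 := h.neg_integral_log_partition_le (n := n + 1) hτ hM hφ hφ1 hv
  push_cast at h2
  have h3 := h1.trans h2
  rw [one_div, inv_mul_le_iff₀ hn]
  have h4 : ((n : ℝ) + 1) * (∫ x, (linComb φ v x - f x) ^ 2 ∂P.fst +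
      4 * β / (n + 1) * ∑ j, Real.log (1 + τ⁻¹ * |v j|) + (4 * τ ^ 2 * M + β / (n + 1))) =
      β * transCost τ v + ((n : ℝ) + 1) * (∫ x, (linComb φ v x - f x) ^ 2 ∂P.fst +
        4 * τ ^ 2 * M) := by
    rw [transCost]
    field_simp
    ring
  rw [h4]
  -- The argument yields 2τ²M; the difference from the stated 4τ²M is discarded.
  have h5 : 0 ≤ ((n : ℝ) + 1) * (2 * τ ^ 2 * M) := by positivity
  nlinarith

end Oracle

/-! ### From essential suprema to simultaneous almost sure bounds. -/

section EssentialBounds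

variable {𝒳 : Type*} [MeasurableSpace 𝒳] {ν : Measure 𝒳} {M : ℕ} {f : 𝒳 → ℝ}
  {φ : Fin M → 𝒳 → ℝ}

lemma ae_abs_le_of_eLpNorm_top_le {g : 𝒳 → ℝ} {C : ℝ} (hC : 0 ≤ C)
    (h : eLpNorm g ∞ ν ≤ ENNReal.ofReal C) : ∀ᵐ x ∂ν, |g x| ≤ C := by
  rw [eLpNorm_exponent_top] at h
  filter_upwards [ae_le_eLpNormEssSup (f := g) (μ := ν)] with x hx
  have := hx.trans h
  rwa [Real.enorm_eq_ofReal_abs, ENNReal.ofReal_le_ofReal_iff hC] at this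

/-- Essential bounds which hold for every coefficient vector of a set hold simultaneously for
almost every design point. -/
lemma ae_forall_abs_linComb_sub_le {S : Set (Fin M → ℝ)} {C : ℝ} (hC : 0 ≤ C)
    (h : ∀ w ∈ S, eLpNorm (fun x => linComb φ w x - f x) ∞ ν ≤ ENNReal.ofReal C) :
    ∀ᵐ x ∂ν, ∀ w ∈ S, |linComb φ w x - f x| ≤ C := by
  -- The exceptional null set depends on the vector; a countable dense set merges them, and
  -- continuity in `w` extends the bound to all of `S`.
  obtain ⟨D, hD, hDd⟩ := TopologicalSpace.exists_countable_dense S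
  have hae : ∀ᵐ x ∂ν, ∀ w ∈ D, |linComb φ (w : Fin M → ℝ) x - f x| ≤ C :=
    (ae_ball_iff hD).2 fun w _ => ae_abs_le_of_eLpNorm_top_le hC (h w w.2)
  filter_upwards [hae] with x hx w hw
  have hcl : IsClosed {w : S | |linComb φ (w : Fin M → ℝ) x - f x| ≤ C} := by
    have := continuous_linComb (φ := φ) x
    exact isClosed_le (by fun_prop) continuous_const
  have hsub : closure D ⊆ {w : S | |linComb φ (w : Fin M → ℝ) x - f x| ≤ C} :=
    hcl.closure_subset_iff.2 hx
  exact hsub (hDd.closure_eq ▸ Set.mem_univ (⟨w, hw⟩ : S))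

end EssentialBounds

end MirrorAveraging

end

/-! ### The main theorem. -/

open MirrorAveraging
theorem proposition1 {𝒳 : Type*} [MeasurableSpace 𝒳]
    -- the law of one observation `(X, Y)`, and the regression function
    (P : Measure (𝒳 × ℝ)) [IsProbabilityMeasure P]
    (f : 𝒳 → ℝ) (hf : IsRegressionFunction P f)
    (hξ : MemLp (fun z : 𝒳 × ℝ => z.2 - f z.1) 2 P)
    -- sample size, and the normalized, bounded dictionary
    (n M : ℕ) (hM : 2 ≤ M)
    (φ : Fin M → 𝒳 → ℝ) (hφ : ∀ j, Measurable (φ j))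
    (hφ_two : ∀ j, eLpNorm (φ j) 2 P.fst = 1)
    (Lφ : ℝ) (hLφ : 0 < Lφ) (hφ_top : ∀ j, eLpNorm (φ j) ∞ P.fst ≤ ENNReal.ofReal Lφ)
    -- conditional exponential moments of the errors
    (σ b : ℝ) (hσ : 0 < σ) (hb : 0 < b) (hmom : CondExpMoment P f σ b)
    -- parameters of the prior, and temperature
    (τ R : ℝ) (hτ : 0 < τ) (hR : 0 < R)
    (β : ℝ)
    (hβ : max
        (ENNReal.ofReal (2 * σ ^ 2) +
          2 * (⨆ w ∈ l1ball M R, eLpNorm (fun x => linComb φ w x - f x) ∞ P.fst) ^ 2)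
        (ENNReal.ofReal (4 * R * Lφ / b)) ≤ ENNReal.ofReal β) :
    Measurable (fun p : (Fin n → 𝒳 × ℝ) × 𝒳 =>
      maAggregate φ β (sparsityPrior M τ R) p.1 p.2) ∧
    ∫⁻ Z, sqLoss P.fst (maAggregate φ β (sparsityPrior M τ R) Z) f
        ∂(Measure.pi (fun _ : Fin n => P)) ≤
      (⨅ (w : Fin M → ℝ) (_ : l1norm w ≤ R - 2 * M * τ),
        (sqLoss P.fst (linComb φ w) f +
          ENNReal.ofReal (4 * β / (n + 1) * ∑ j, Real.log (1 + τ⁻¹ * |w j|)))) +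
      ENNReal.ofReal (4 * τ ^ 2 * M + β / (n + 1)) := by
  have hprob := isProbabilityMeasure_sparsityPrior (M := M) hτ hR
  refine ⟨measurable_maAggregate hφ, ?_⟩
  set S := ⨆ w ∈ l1ball M R, eLpNorm (fun x => linComb φ w x - f x) ∞ P.fst with hS
  have hβ1 := (le_max_left _ _).trans hβ
  have hβ2 := (le_max_right _ _).trans hβ
  have hβ0 : 0 < β := by
    have h := (le_add_right le_rfl).trans hβ1
    rw [ENNReal.ofReal_le_ofReal_iff'] at h
    rcases h with h | h <;> nlinarith [pow_pos hσ 2]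
  -- A finite temperature forces the supremum to be finite, so `S.toReal` can serve as the bound L.
  have hStop : S ≠ ∞ := by
    intro h
    rw [h] at hβ1
    simp at hβ1
  have hSL : ENNReal.ofReal S.toReal = S := ENNReal.ofReal_toReal hStop
  have hdict : ∀ᵐ x ∂P.fst, ∀ j, |φ j x| ≤ Lφ :=
    ae_all_iff.2 fun j => ae_abs_le_of_eLpNorm_top_le hLφ.le (hφ_top j)
  have hadm : Admissible P f φ σ b R S.toReal Lφ β :=
    { regression := hf
      memLp := hξ
      measurable_dict := hφ
      dict_bound := hdict
      dev_bound := ae_forall_abs_linComb_sub_le ENNReal.toReal_nonneg fun w hw => by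
        rw [hSL]
        exact le_iSup₂ (f := fun w (_ : w ∈ l1ball M R) =>
          eLpNorm (fun x => linComb φ w x - f x) ∞ P.fst) w hw
      moment := hmom
      sigma_pos := hσ
      dict_nonneg := hLφ.le
      radius_pos := hR
      temp_dev := by
        rw [← hSL, ← ENNReal.ofReal_pow ENNReal.toReal_nonneg, ← ENNReal.ofReal_ofNat 2,
          ← ENNReal.ofReal_mul (by norm_num), ← ENNReal.ofReal_add (by positivity) (by positivity),
          ENNReal.ofReal_le_ofReal_iff hβ0.le] at hβ1
        exact hβ1
      temp_dict := by
        rw [ENNReal.ofReal_le_ofReal_iff hβ0.le, div_le_iff₀ hb] at hβ2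
        linarith }
  have hφI : ∀ j, Integrable (fun x => φ j x ^ 2) P.fst := fun j => by
    refine Integrable.of_bound (C := Lφ ^ 2) ((hφ j).pow_const 2).aestronglyMeasurable
      (hdict.mono fun x hx => ?_)
    rw [Real.norm_of_nonneg (sq_nonneg _), ← sq_abs]
    gcongr
    exact hx j
  -- Comparison with the zero function reads the L² normalization as a Bochner integral.
  have hφ1 : ∀ j, ∫ x, φ j x ^ 2 ∂P.fst = 1 := fun j => by
    have h1 := sqLoss_eq_ofReal_integral (f := fun _ => 0) (C := Lφ) (hφ j) measurable_const
      (hdict.mono fun x hx => by simpa using hx j)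
    simp only [sqLoss, sub_zero] at h1
    rw [hφ_two j, one_pow] at h1
    exact (ENNReal.ofReal_eq_one.1 h1.symm)
  simp only [ENNReal.iInf_add]
  exact le_iInf₂ fun v hv => hadm.oracle_inequality hτ (by omega) hφI hφ1 hv
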